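/- Let $n\ge 1$, let $E_1,\dots,E_n$ and $F$ be Banach spaces over $\mathbb K=\mathbb R$ or $\mathbb C$, and suppose that each $E_k$ has cotype $2$, i.e. for each $k$ there is a constant $C\ge 0$ such that $$\Bigl(\sum_{j=1}^m\|x_j\|^2\Bigr)^{1/2}\le C\Bigl(2^{-m}\sum_{\varepsilon\in\{-1,1\}^m}\Bigl\|\sum_{j=1}^m\varepsilon_jx_j\Bigr\|^2\Bigr)^{1/2}$$ for all $m$ and all $x_1,\dots,x_m\in E_k$. Then for all real numbers $1\le p\le r<2$, $$\Pi_p^n(E_1,\dots,E_n;F)=\Pi_r^n(E_1,\dots,E_n;F).$$ Here, for $p\ge1$, $\Pi_p^n(E_1,\dots,E_n;F)$ is the set of all multiple $p$-summing mappings, that is, of all continuous $n$-linear mappings $A:E_1\times\cdots\times E_n\to F$ for which there is a constant $C\ge0$ such that $$\Bigl(\sum_{j_1=1}^{m_1}\cdots\sum_{j_n=1}^{m_n}\bigl\|A\bigl(x^{(1)}_{j_1},\dots,x^{(n)}_{j_n}\bigr)\bigr\|^p\Bigr)^{1/p}\le C\prod_{k=1}^n\ \sup_{\varphi\in E_k',\,\|\varphi\|\le1}\Bigl(\sum_{j=1}^{m_k}\bigl|\varphi\bigl(x^{(k)}_j\bigr)\bigr|^p\Bigr)^{1/p}$$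 for all $m_1,\dots,m_n$ and all $x^{(k)}_j\in E_k$ ($1\le j\le m_k$, $1\le k\le n$). -/

import Mathlib

/-- The Banach space `E` has (Rademacher) cotype `q`: there is a constant `C ≥ 0` with
`(∑ j, ‖x j‖ ^ q) ^ (1/q) ≤ C * (average over all signs of ‖∑ j, ε j x j‖ ^ 2) ^ (1/2)`
for all finite families in `E`. The average over the `2 ^ m` choices of signs is the integral
over `[0,1]` of `‖∑ j, r_j(t) x j‖ ^ 2`, with `r_j` the Rademacher functions. -/
def HasCotype (q : ℝ) (E : Type*) [NormedAddCommGroup E] : Prop :=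
  ∃ C : ℝ, 0 ≤ C ∧ ∀ (m : ℕ) (x : Fin m → E),
    (∑ j, ‖x j‖ ^ q) ^ (1 / q) ≤
      C * ((∑ ε : Fin m → ℤˣ, ‖∑ j, ((ε j : ℤˣ) : ℤ) • x j‖ ^ (2 : ℝ)) / 2 ^ m) ^ (1 / 2 : ℝ)

/-- The weak `ℓ_p` norm of a finite family: the supremum of `(∑ j, ‖φ (x j)‖ ^ p) ^ (1/p)`
over the functionals `φ` in the closed unit ball of the dual. -/
noncomputable def weakLpNorm (𝕜 : Type*) [RCLike 𝕜] {E : Type*} [NormedAddCommGroup E]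
    [NormedSpace 𝕜 E] (p : ℝ) {m : ℕ} (x : Fin m → E) : ℝ :=
  ⨆ φ : {φ : StrongDual 𝕜 E // ‖φ‖ ≤ 1}, (∑ j, ‖φ.1 (x j)‖ ^ p) ^ (1 / p)

/-- The supremum defining `weakLpNorm` is over a bounded set, hence a genuine supremum. -/
theorem weakLpNorm_bddAbove (𝕜 : Type*) [RCLike 𝕜] {E : Type*} [NormedAddCommGroup E]
    [NormedSpace 𝕜 E] {p : ℝ} (hp : 1 ≤ p) {m : ℕ} (x : Fin m → E) :
    BddAbove (Set.range fun φ : {φ : StrongDual 𝕜 E // ‖φ‖ ≤ 1} =>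
      (∑ j, ‖φ.1 (x j)‖ ^ p) ^ (1 / p)) := by
  refine ⟨(∑ j, ‖x j‖ ^ p) ^ (1 / p), ?_⟩
  rintro _ ⟨φ, rfl⟩
  have h (j : Fin m) : ‖φ.1 (x j)‖ ≤ ‖x j‖ := by
    simpa using φ.1.le_of_opNorm_le φ.2 (x j)
  have hp0 : 0 ≤ p := by linarith
  refine Real.rpow_le_rpow (Finset.sum_nonneg fun j _ => by positivity) ?_ (by positivity)
  exact Finset.sum_le_sum fun j _ => Real.rpow_le_rpow (norm_nonneg _) (h j) hp0

/-- A continuous `n`-linear mapping `A` is multiple `(q; p 0, …, p (n-1))`-summing. -/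
def IsMultipleSumming {𝕜 : Type*} [RCLike 𝕜] {n : ℕ} {E : Fin n → Type*}
    [∀ k, NormedAddCommGroup (E k)] [∀ k, NormedSpace 𝕜 (E k)]
    {F : Type*} [NormedAddCommGroup F] [NormedSpace 𝕜 F]
    (q : ℝ) (p : Fin n → ℝ) (A : ContinuousMultilinearMap 𝕜 E F) : Prop :=
  ∃ C : ℝ, 0 ≤ C ∧ ∀ (m : Fin n → ℕ) (x : ∀ k, Fin (m k) → E k),
    (∑ j : (∀ k, Fin (m k)), ‖A fun k => x k (j k)‖ ^ q) ^ (1 / q) ≤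
      C * ∏ k, weakLpNorm 𝕜 (p k) (x k)

/-- The class `Π_p^n(E_1, …, E_n; F)` of multiple `p`-summing (that is, multiple
`(p; p, …, p)`-summing) mappings, as a subset of the continuous `n`-linear mappings. -/
def multipleSummingMaps (𝕜 : Type*) [RCLike 𝕜] {n : ℕ} (E : Fin n → Type*)
    [∀ k, NormedAddCommGroup (E k)] [∀ k, NormedSpace 𝕜 (E k)]
    (F : Type*) [NormedAddCommGroup F] [NormedSpace 𝕜 F] (p : ℝ) :
    Set (ContinuousMultilinearMap 𝕜 E F) :=
  {A | IsMultipleSumming p (fun _ => p) A}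

/-!
All the classes with exponent `1 ≤ r < 2` coincide with the class of exponent `1`
(`multipleSummingMaps_eq_one`); the two inclusions have different reasons.

*From `r` to `1`.* A family `x` in `E` defines the operator `c ↦ ∑ j, c j • x j` on `ℓ_∞^N`, whose
norm is the weak `ℓ_1` norm of `x`. If `E` has cotype two, this operator is bounded for the norm of
`L_2(μ)` for some weight `μ` of total mass at most one, with a constant independent of `N`
(`exists_weight_of_cotype_two`, after Maurey). Indeed an `L_2(μ)` estimate with constant `√K`
interpolates with the sup norm to an `L_4(μ)` estimate with constant of order `K ^ (1 / 4)`; cotype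
two and Khinchin's inequality turn it into a square function estimate, and Pietsch domination
(`exists_weight_of_sum_le`) gives back an `L_2(ν)` estimate with constant of order `K ^ (1 / 4)`.
Hence the best constant is bounded. It follows that `x j = a j • y j` with `a` in the unit ball of
`ℓ_s`, `1 / r + 1 / s = 1`, and `y` weakly `r`-summable (`HasCotype.exists_smul_factorization`), and
Hölder's inequality concludes.

*From `1` to `r`.* Here the spaces are arbitrary. For `r < 2`, independent symmetric random variables
`θ j` with tails of order `t ^ (-r)` satisfy `𝔼 |∑ θ j c j| ≲ (∑ |c j| ^ r) ^ (1 / r)` for scalars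
and `(∑ ‖z j‖ ^ r) ^ (1 / r) ≲ 𝔼 ‖∑ θ j z j‖` for vectors in any normed space. Variables with
finitely many values suffice, so the expectations are finite sums (`exists_stable_coefficients`).
The first estimate bounds the weak `ℓ_1` norm of the random combinations of a weakly `r`-summable
family; the second, tensorized over the coordinates (`rpow_sum_le_sum_prod_smul`), recovers the
multiple `ℓ_r` sum from the multiple `ℓ_1` sum of these combinations.
-/

/-! ### Moments of Rademacher sums -/

theorem sum_sign_succ {n : ℕ} (g : (Fin (n + 1) → ℤˣ) → ℝ) :
    ∑ ε, g ε = ∑ ε : Fin n → ℤˣ, (g (Fin.cons 1 ε) + g (Fin.cons (-1) ε)) := by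
  rw [← (Fin.consEquiv (fun _ : Fin (n + 1) => ℤˣ)).sum_comp, Fintype.sum_prod_type,
    UnitsInt.univ, Finset.sum_pair (by decide), ← Finset.sum_add_distrib]
  rfl

theorem sum_sign_sq {n : ℕ} (c : Fin n → ℝ) :
    ∑ ε : Fin n → ℤˣ, (∑ j, ((ε j : ℤ) : ℝ) * c j) ^ 2 = 2 ^ n * ∑ j, c j ^ 2 := by
  induction n with
  | zero => simp
  | succ n ih =>
    have h (S : ℝ) : (c 0 + S) ^ 2 + (-c 0 + S) ^ 2 = 2 * c 0 ^ 2 + 2 * S ^ 2 := by ring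
    simp only [sum_sign_succ, Fin.sum_univ_succ, Fin.cons_zero, Fin.cons_succ, Units.val_one,
      Units.val_neg, Int.cast_one, Int.cast_neg, one_mul, neg_one_mul, h, Finset.sum_add_distrib,
      ← Finset.mul_sum, ih (fun j => c j.succ)]
    simp
    ring

/-- The fourth moment form of Khinchin's inequality. -/
theorem sum_sign_pow_four_le {n : ℕ} (c : Fin n → ℝ) :
    ∑ ε : Fin n → ℤˣ, (∑ j, ((ε j : ℤ) : ℝ) * c j) ^ 4 ≤ 2 ^ n * (3 * (∑ j, c j ^ 2) ^ 2) := by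
  induction n with
  | zero => simp
  | succ n ih =>
    have h (S : ℝ) : (c 0 + S) ^ 4 + (-c 0 + S) ^ 4 =
        2 * c 0 ^ 4 + 12 * c 0 ^ 2 * S ^ 2 + 2 * S ^ 4 := by ring
    have ih' := ih (fun j => c j.succ)
    simp only [sum_sign_succ, Fin.sum_univ_succ, Fin.cons_zero, Fin.cons_succ, Units.val_one,
      Units.val_neg, Int.cast_one, Int.cast_neg, one_mul, neg_one_mul, h, Finset.sum_add_distrib,
      ← Finset.mul_sum, sum_sign_sq (fun j => c j.succ)]
    simp only [Finset.sum_const, Finset.card_univ, Fintype.card_pi, Fintype.card_units_int,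
      Finset.prod_const, Fintype.card_fin, nsmul_eq_mul, Nat.cast_pow, Nat.cast_ofNat]
    have h4 : (0 : ℝ) ≤ 2 ^ n * c 0 ^ 4 := by positivity
    rw [pow_succ (2 : ℝ) n]
    linarith [show (2 : ℝ) ^ n * 2 * (3 * (c 0 ^ 2 + ∑ j : Fin n, c j.succ ^ 2) ^ 2) =
      6 * (2 ^ n * c 0 ^ 4) + 12 * c 0 ^ 2 * (2 ^ n * ∑ j : Fin n, c j.succ ^ 2) +
        2 * (2 ^ n * (3 * (∑ j : Fin n, c j.succ ^ 2) ^ 2)) by ring,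
      show (2 : ℝ) * (2 ^ n * c 0 ^ 4) ≤ 6 * (2 ^ n * c 0 ^ 4) by linarith]

/-- Each term of a Rademacher sum is dominated by the average over the signs: two sign patterns
that differ only at `j` give sums whose difference is `± 2 z j`. -/
theorem norm_le_sum_sign {G : Type*} [NormedAddCommGroup G] [NormedSpace ℝ G] {n : ℕ}
    (z : Fin n → G) (j : Fin n) :
    2 ^ n * ‖z j‖ ≤ ∑ ε : Fin n → ℤˣ, ‖∑ i, ((ε i : ℤˣ) : ℤ) • z i‖ := by
  let e := Equiv.mulRight (Pi.mulSingle j (-1) : Fin n → ℤˣ)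
  have key (ε : Fin n → ℤˣ) : 2 * ‖z j‖ ≤
      ‖∑ i, ((ε i : ℤˣ) : ℤ) • z i‖ + ‖∑ i, ((e ε i : ℤˣ) : ℤ) • z i‖ := by
    refine le_trans (le_of_eq ?_) (norm_sub_le _ _)
    rw [← Finset.sum_sub_distrib, Finset.sum_eq_single j]
    · have : ((ε j : ℤˣ) : ℤ) • z j - ((e ε j : ℤˣ) : ℤ) • z j
          = ((ε j : ℤˣ) : ℤ) • ((2 : ℕ) • z j) := by
        simp [e, two_smul]
      rw [this]
      have h2 : ‖(2 : ℕ) • z j‖ = 2 * ‖z j‖ := by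
        rw [RCLike.norm_nsmul ℝ, nsmul_eq_mul, Nat.cast_ofNat]
      rcases Int.units_eq_one_or (ε j) with h | h <;>
        simp only [h, Units.val_one, one_smul, Units.val_neg, neg_smul, norm_neg, h2]
    · intro i _ hi
      simp [e, hi]
    · simp
  have hsum := Finset.sum_le_sum fun ε (_ : ε ∈ Finset.univ) => key ε
  rw [Finset.sum_add_distrib,
    Equiv.sum_comp e (fun ε : Fin n → ℤˣ => ‖∑ i, ((ε i : ℤˣ) : ℤ) • z i‖)] at hsum
  simp at hsum
  linarith

/-! ### Pietsch domination on a finite set -/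

/-- Pietsch's domination theorem on the finite set `Fin N`, for a functional `q` homogeneous of
degree two; the measure comes from separating the convex hull of the functions
`j ↦ q f - B * f j ^ 2` from the open positive cone. -/
theorem exists_weight_of_sum_le {N : ℕ} (q : (Fin N → ℝ) → ℝ)
    (hq : ∀ (t : ℝ) f, q (t • f) = t ^ 2 * q f) {B : ℝ}
    (h : ∀ (m : ℕ) (f : Fin m → Fin N → ℝ) (M : ℝ), 0 ≤ M → (∀ j, ∑ i, f i j ^ 2 ≤ M) →
      ∑ i, q (f i) ≤ B * M) :
    ∃ μ : Fin N → ℝ, (∀ j, 0 ≤ μ j) ∧ ∑ j, μ j ≤ 1 ∧ ∀ f, q f ≤ B * ∑ j, μ j * f j ^ 2 := by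
  rcases Nat.eq_zero_or_pos N with rfl | hN
  · refine ⟨0, by simp, by simp, fun f => ?_⟩
    simpa using h 1 (fun _ => f) 0 le_rfl (fun j => j.elim0)
  have : Nonempty (Fin N) := ⟨⟨0, hN⟩⟩
  let v : (Fin N → ℝ) → Fin N → ℝ := fun f j => q f - B * f j ^ 2
  let P : Set (Fin N → ℝ) := {p | ∀ j, 0 < p j}
  have hP : P = Set.univ.pi fun _ => Set.Ioi 0 := by ext; simp [P]
  have hPc : Convex ℝ P := by
    rw [hP]; exact convex_pi fun _ _ => convex_Ioi 0
  have hPo : IsOpen P := by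
    rw [hP]; exact isOpen_set_pi Set.finite_univ fun _ _ => isOpen_Ioi
  have hdisj : Disjoint P (convexHull ℝ (Set.range v)) := by
    rw [Set.disjoint_left]
    intro p hp hpD
    rw [mem_convexHull_iff_exists_fintype] at hpD
    obtain ⟨ι, _, w, z, hw, -, hz, rfl⟩ := hpD
    choose g hg using hz
    let e := Fintype.equivFin ι
    -- By homogeneity a convex combination of the `v (g i)` comes from the family `√(w i) • g i`.
    let f : Fin (Fintype.card ι) → Fin N → ℝ := fun i => √(w (e.symm i)) • g (e.symm i)
    obtain ⟨j, -, hj⟩ := Finset.exists_max_image Finset.univ (fun j => ∑ i, f i j ^ 2)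
      Finset.univ_nonempty
    have h1 := h _ f (∑ i, f i j ^ 2) (Finset.sum_nonneg fun i _ => sq_nonneg _)
      (fun j' => hj j' (Finset.mem_univ _))
    have h2 := hp j
    have h3 : ∑ i, q (f i) = ∑ i, w i * q (g i) := by
      rw [← e.symm.sum_comp]
      exact Finset.sum_congr rfl fun i _ => by rw [hq, Real.sq_sqrt (hw _)]
    have h4 : ∑ i, f i j ^ 2 = ∑ i, w i * g i j ^ 2 := by
      rw [← e.symm.sum_comp]
      exact Finset.sum_congr rfl fun i _ => by
        simp only [f, Pi.smul_apply, smul_eq_mul, mul_pow, Real.sq_sqrt (hw _)]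
    rw [h3, h4, Finset.mul_sum] at h1
    simp only [← hg, Finset.sum_apply, Pi.smul_apply, smul_eq_mul, v, mul_sub,
      Finset.sum_sub_distrib] at h2
    have h5 : ∑ i, w i * (B * g i j ^ 2) = ∑ i, B * (w i * g i j ^ 2) :=
      Finset.sum_congr rfl fun i _ => by ring
    linarith
  obtain ⟨l, u, hl1, hl2⟩ := geometric_hahn_banach_open hPc hPo (convex_convexHull ℝ _) hdisj
  have hsmul1 (δ : ℝ) (hδ : 0 < δ) : δ * l 1 < u := by
    have := hl1 (δ • 1) (fun j => by simpa using hδ)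
    simpa using this
  have hu : u ≤ 0 := by
    have := hl2 0 (subset_convexHull ℝ _ ⟨0, by
      have h0 : q 0 = 0 := by simpa using hq 0 0
      ext j; simp [v, h0]⟩)
    simpa using this
  have hone : l 1 < 0 := by
    have := hsmul1 1 one_pos
    linarith
  have hu0 : 0 ≤ u := by
    by_contra! hneg
    have h1 := hsmul1 (u / (2 * l 1)) (div_pos_of_neg_of_neg hneg (by linarith))
    have h2 : u / (2 * l 1) * l 1 = u / 2 := by have := hone.ne; field_simp
    linarith
  have hν (j : Fin N) : l (Pi.single j 1) ≤ 0 := by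
    by_contra! hpos
    set δ := l (Pi.single j 1) / (-l 1) with hδ
    have hδ0 : 0 < δ := div_pos hpos (by linarith)
    have h1 := hl1 (Pi.single j 1 + δ • 1) (fun i => by
      have : (0 : ℝ) ≤ (Pi.single j 1 : Fin N → ℝ) i := by
        rw [Pi.single_apply]; split_ifs <;> simp
      simp only [Pi.add_apply, Pi.smul_apply, Pi.one_apply, smul_eq_mul, mul_one]
      linarith)
    rw [map_add, map_smul, smul_eq_mul] at h1
    have h2 : δ * l 1 = -l (Pi.single j 1) := by
      rw [hδ]; have := hone.ne; field_simp
    linarith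
  have hexp (f : Fin N → ℝ) : l f = ∑ j, f j * l (Pi.single j 1) := by
    conv_lhs => rw [pi_eq_sum_univ' f]
    simp [map_sum]
  refine ⟨fun j => l (Pi.single j 1) / l 1, fun j => div_nonneg_of_nonpos (hν j) hone.le, ?_, ?_⟩
  · rw [← Finset.sum_div]
    have := hexp 1
    simp only [Pi.one_apply, one_mul] at this
    rw [← this, div_self hone.ne]
  · intro f
    have h1 : 0 ≤ l (v f) := hu0.trans (hl2 _ (subset_convexHull ℝ _ ⟨f, rfl⟩))
    have h2 : v f = q f • 1 - B • fun j => f j ^ 2 := by ext j; simp [v]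
    rw [h2, map_sub, map_smul, map_smul, smul_eq_mul, smul_eq_mul, hexp (fun j => f j ^ 2)] at h1
    have h3 : ∑ j, l (Pi.single j 1) / l 1 * f j ^ 2 =
        (∑ j, f j ^ 2 * l (Pi.single j 1)) / l 1 := by
      rw [Finset.sum_div]
      exact Finset.sum_congr rfl fun j _ => by ring
    rw [h3, ← mul_div_assoc, le_div_iff_of_neg hone]
    linarith

/-! ### Operators from a finite-dimensional `ℓ_∞` into a space of cotype two -/

/-- Interpolation between the sup norm and `L_2(μ)`: cutting `f` at the height `τ` with
`τ ^ 4 = K * ∫ f ^ 4 dμ` bounds the two parts of `T f` by `τ` each. -/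
theorem norm_pow_four_le_of_norm_sq_le {E : Type*} [NormedAddCommGroup E] [NormedSpace ℝ E] {N : ℕ}
    (T : (Fin N → ℝ) →ₗ[ℝ] E) (hT : ∀ f t, (∀ j, |f j| ≤ t) → ‖T f‖ ≤ t)
    {μ : Fin N → ℝ} (hμ : ∀ j, 0 ≤ μ j) {K : ℝ} (hK : 0 ≤ K)
    (h : ∀ f, ‖T f‖ ^ 2 ≤ K * ∑ j, μ j * f j ^ 2) (f : Fin N → ℝ) :
    ‖T f‖ ^ 4 ≤ 16 * (K * ∑ j, μ j * f j ^ 4) := by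
  set Q := ∑ j, μ j * f j ^ 4 with hQ
  have hQ0 : 0 ≤ Q := Finset.sum_nonneg fun j _ => mul_nonneg (hμ j) (by positivity)
  -- `δ` keeps the height `τ` positive when the fourth moment vanishes.
  have key (δ : ℝ) (hδ : 0 < δ) : ‖T f‖ ^ 4 ≤ 16 * (K * Q + δ) := by
    have hpos : 0 < K * Q + δ := by positivity
    set τ := √√(K * Q + δ) with hτ
    have hτ0 : 0 < τ := Real.sqrt_pos.2 (Real.sqrt_pos.2 hpos)
    have hτ4 : τ ^ 4 = K * Q + δ := by
      rw [show τ ^ 4 = (τ ^ 2) ^ 2 by ring, hτ, Real.sq_sqrt (Real.sqrt_nonneg _),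
        Real.sq_sqrt hpos.le]
    have h1 : ‖T fun j => if |f j| ≤ τ then f j else 0‖ ≤ τ := by
      refine hT _ _ fun j => ?_
      split_ifs with hj
      · exact hj
      · simpa using hτ0.le
    have h2 : ‖T fun j => if |f j| ≤ τ then 0 else f j‖ ≤ τ := by
      refine le_of_sq_le_sq ?_ hτ0.le
      refine (h _).trans ?_
      have h3 : (∑ j, μ j * (if |f j| ≤ τ then 0 else f j) ^ 2) * τ ^ 2 ≤ Q := by
        rw [Finset.sum_mul]
        refine Finset.sum_le_sum fun j _ => ?_
        rw [mul_assoc]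
        refine mul_le_mul_of_nonneg_left ?_ (hμ j)
        split_ifs with hj
        · simp; positivity
        · have : τ ^ 2 ≤ f j ^ 2 := sq_le_sq.2 (by rw [abs_of_pos hτ0]; exact (not_le.1 hj).le)
          nlinarith [sq_nonneg (f j)]
      refine le_of_mul_le_mul_right ?_ (pow_pos hτ0 2)
      nlinarith
    have h3 : ‖T f‖ ≤ 2 * τ := by
      have hsplit : f = (fun j => if |f j| ≤ τ then f j else 0) +
          fun j => if |f j| ≤ τ then 0 else f j := by
        ext j
        simp only [Pi.add_apply]
        split_ifs <;> simp
      rw [hsplit, map_add]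
      exact (norm_add_le _ _).trans (by linarith)
    calc ‖T f‖ ^ 4 ≤ (2 * τ) ^ 4 := by gcongr
      _ = 16 * (K * Q + δ) := by rw [mul_pow, hτ4]; norm_num
  refine le_of_forall_pos_le_add fun δ hδ => ?_
  have := key (δ / 16) (by positivity)
  linarith

/-- The self-improvement of the constant in an `L_2` estimate for `T`: such an estimate yields an
`L_4` estimate, which cotype two and Khinchin's inequality turn back into an `L_2` estimate. -/
theorem exists_weight_improve {E : Type*} [NormedAddCommGroup E] [NormedSpace ℝ E] {C : ℝ}
    (hC : 0 ≤ C) (hE : ∀ (m : ℕ) (x : Fin m → E), ∑ j, ‖x j‖ ^ 2 ≤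
      C * ((∑ ε : Fin m → ℤˣ, ‖∑ j, ((ε j : ℤˣ) : ℤ) • x j‖ ^ 2) / 2 ^ m)) {N : ℕ}
    (T : (Fin N → ℝ) →ₗ[ℝ] E) (hT : ∀ f t, (∀ j, |f j| ≤ t) → ‖T f‖ ≤ t)
    {μ : Fin N → ℝ} (hμ : ∀ j, 0 ≤ μ j) (hμ1 : ∑ j, μ j ≤ 1) {K : ℝ} (hK : 0 ≤ K)
    (h : ∀ f, ‖T f‖ ^ 2 ≤ K * ∑ j, μ j * f j ^ 2) :
    ∃ ν : Fin N → ℝ, (∀ j, 0 ≤ ν j) ∧ ∑ j, ν j ≤ 1 ∧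
      ∀ f, ‖T f‖ ^ 2 ≤ C * √(48 * K) * ∑ j, ν j * f j ^ 2 := by
  refine exists_weight_of_sum_le (fun f => ‖T f‖ ^ 2) (fun t f => ?_) fun m f M hM hf => ?_
  · simp [norm_smul, mul_pow]
  refine (hE m fun i => T (f i)).trans ?_
  rw [mul_assoc]
  refine mul_le_mul_of_nonneg_left ?_ hC
  have hTε (ε : Fin m → ℤˣ) : ∑ i, ((ε i : ℤˣ) : ℤ) • T (f i) =
      T (fun j => ∑ i, ((ε i : ℤ) : ℝ) * f i j) := by
    have : (fun j => ∑ i, ((ε i : ℤ) : ℝ) * f i j) = ∑ i, ((ε i : ℤˣ) : ℤ) • f i := by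
      ext j; simp
    rw [this, map_sum]
    exact Finset.sum_congr rfl fun i _ => (map_zsmul T _ _).symm
  simp only [hTε]
  set S := ∑ ε : Fin m → ℤˣ, ‖T (fun j => ∑ i, ((ε i : ℤ) : ℝ) * f i j)‖ ^ 2 with hS
  have h2m : (0 : ℝ) < 2 ^ m := by positivity
  have hcs : S ^ 2 ≤ 2 ^ m * ∑ ε : Fin m → ℤˣ,
      ‖T (fun j => ∑ i, ((ε i : ℤ) : ℝ) * f i j)‖ ^ 4 := by
    have := sq_sum_le_card_mul_sum_sq (s := (Finset.univ : Finset (Fin m → ℤˣ)))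
      (f := fun ε => ‖T (fun j => ∑ i, ((ε i : ℤ) : ℝ) * f i j)‖ ^ 2)
    simpa [← pow_mul] using this
  have h4 : ∑ ε : Fin m → ℤˣ, ‖T (fun j => ∑ i, ((ε i : ℤ) : ℝ) * f i j)‖ ^ 4 ≤
      2 ^ m * (48 * K * M ^ 2) := by
    calc ∑ ε : Fin m → ℤˣ, ‖T (fun j => ∑ i, ((ε i : ℤ) : ℝ) * f i j)‖ ^ 4
        ≤ ∑ ε : Fin m → ℤˣ, 16 * (K * ∑ j, μ j * (∑ i, ((ε i : ℤ) : ℝ) * f i j) ^ 4) :=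
          Finset.sum_le_sum fun ε _ => norm_pow_four_le_of_norm_sq_le T hT hμ hK h _
      _ = 16 * (K * ∑ j, μ j * ∑ ε : Fin m → ℤˣ, (∑ i, ((ε i : ℤ) : ℝ) * f i j) ^ 4) := by
          rw [← Finset.mul_sum, ← Finset.mul_sum, Finset.sum_comm]
          simp only [Finset.mul_sum]
      _ ≤ 16 * (K * ∑ j, μ j * (2 ^ m * (3 * M ^ 2))) := by
          gcongr with j _
          · exact hμ j
          · refine (sum_sign_pow_four_le _).trans ?_
            have := hf j
            gcongr
      _ = (∑ j, μ j) * (2 ^ m * (48 * K * M ^ 2)) := by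
          rw [← Finset.sum_mul]; ring
      _ ≤ 1 * (2 ^ m * (48 * K * M ^ 2)) := by gcongr
      _ = _ := one_mul _
  rw [div_le_iff₀ h2m]
  refine le_of_sq_le_sq (hcs.trans ?_) (by positivity)
  rw [mul_pow, mul_pow, Real.sq_sqrt (by positivity)]
  nlinarith

/-- An operator `T` from `ℓ_∞^N` into a space of cotype two satisfies an `L_2(μ)` estimate whose
constant does not depend on `N`: the best constant `K` satisfies `K ≤ C * √(48 * K)`. -/
theorem exists_weight_of_cotype_two {E : Type*} [NormedAddCommGroup E] [NormedSpace ℝ E] {C : ℝ}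
    (hC : 0 ≤ C) (hE : ∀ (m : ℕ) (x : Fin m → E), ∑ j, ‖x j‖ ^ 2 ≤
      C * ((∑ ε : Fin m → ℤˣ, ‖∑ j, ((ε j : ℤˣ) : ℤ) • x j‖ ^ 2) / 2 ^ m)) {N : ℕ}
    (T : (Fin N → ℝ) →ₗ[ℝ] E) (hT : ∀ f t, (∀ j, |f j| ≤ t) → ‖T f‖ ≤ t) :
    ∃ μ : Fin N → ℝ, (∀ j, 0 ≤ μ j) ∧ ∑ j, μ j ≤ 1 ∧
      ∀ f, ‖T f‖ ^ 2 ≤ (48 * C ^ 2 + 1) * ∑ j, μ j * f j ^ 2 := by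
  let S : Set ℝ := {K | 0 ≤ K ∧ ∃ μ : Fin N → ℝ, (∀ j, 0 ≤ μ j) ∧ ∑ j, μ j ≤ 1 ∧
      ∀ f, ‖T f‖ ^ 2 ≤ K * ∑ j, μ j * f j ^ 2}
  have hne : S.Nonempty := by
    refine ⟨N, Nat.cast_nonneg _, fun _ => (N : ℝ)⁻¹, fun _ => by positivity, ?_, fun f => ?_⟩
    · simpa using mul_inv_le_one
    · have h0 : 0 ≤ ∑ j, f j ^ 2 := Finset.sum_nonneg fun _ _ => sq_nonneg _
      have h1 : ‖T f‖ ≤ √(∑ j, f j ^ 2) := hT f _ fun j => Real.abs_le_sqrt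
        (Finset.single_le_sum (f := fun j => f j ^ 2) (fun _ _ => sq_nonneg _)
          (Finset.mem_univ j))
      have h2 : ‖T f‖ ^ 2 ≤ ∑ j, f j ^ 2 := (Real.le_sqrt (norm_nonneg _) h0).1 h1
      refine h2.trans (le_of_eq ?_)
      rw [← Finset.mul_sum]
      rcases Nat.eq_zero_or_pos N with rfl | hN
      · simp
      · field_simp
  have hbdd : BddBelow S := ⟨0, fun K hK => hK.1⟩
  set π := sInf S with hπ
  have hπ0 : 0 ≤ π := Real.sInf_nonneg fun K hK => hK.1
  have hle : π ≤ 48 * C ^ 2 := by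
    by_contra! hlt
    have hππ : 0 < π := lt_of_le_of_lt (by positivity) hlt
    -- Some admissible `K` is so close to `π` that `C * √(48 * K) < π`.
    have : ∃ K ∈ S, 48 * C ^ 2 * K < π ^ 2 := by
      rcases eq_or_lt_of_le (show 0 ≤ 48 * C ^ 2 by positivity) with h0 | h0
      · obtain ⟨K, hK⟩ := hne
        exact ⟨K, hK, by rw [← h0, zero_mul]; positivity⟩
      · obtain ⟨K, hK, hKlt⟩ := exists_lt_of_csInf_lt hne
          (show π < π ^ 2 / (48 * C ^ 2) by rw [lt_div_iff₀ h0]; nlinarith)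
        refine ⟨K, hK, ?_⟩
        rw [lt_div_iff₀ h0] at hKlt
        linarith
    obtain ⟨K, ⟨hK0, μ, hμ, hμ1, hμT⟩, hKlt⟩ := this
    have hmem : C * √(48 * K) ∈ S :=
      ⟨by positivity, exists_weight_improve hC hE T hT hμ hμ1 hK0 hμT⟩
    have h1 : π ≤ C * √(48 * K) := csInf_le hbdd hmem
    have h2 : π ^ 2 ≤ (C * √(48 * K)) ^ 2 := by gcongr
    rw [mul_pow, Real.sq_sqrt (by positivity)] at h2
    linarith
  obtain ⟨K, ⟨hK0, μ, hμ, hμ1, hμT⟩, hKlt⟩ := exists_lt_of_csInf_lt hne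
    (show π < 48 * C ^ 2 + 1 by linarith)
  exact ⟨μ, hμ, hμ1, fun f => (hμT f).trans (mul_le_mul_of_nonneg_right hKlt.le
    (Finset.sum_nonneg fun j _ => mul_nonneg (hμ j) (sq_nonneg _)))⟩

/-! ### The weak norms and their duality -/

section WeakNorm

variable {𝕜 : Type*} [RCLike 𝕜] {E : Type*} [NormedAddCommGroup E] [NormedSpace 𝕜 E] {N : ℕ}

theorem le_weakLpNorm {p : ℝ} (hp : 1 ≤ p) (x : Fin N → E) {φ : StrongDual 𝕜 E} (hφ : ‖φ‖ ≤ 1) :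
    (∑ j, ‖φ (x j)‖ ^ p) ^ (1 / p) ≤ weakLpNorm 𝕜 p x :=
  le_ciSup (weakLpNorm_bddAbove 𝕜 hp x) ⟨φ, hφ⟩

theorem weakLpNorm_le {p : ℝ} {x : Fin N → E} {M : ℝ}
    (h : ∀ φ : StrongDual 𝕜 E, ‖φ‖ ≤ 1 → (∑ j, ‖φ (x j)‖ ^ p) ^ (1 / p) ≤ M) :
    weakLpNorm 𝕜 p x ≤ M := by
  have : Nonempty {φ : StrongDual 𝕜 E // ‖φ‖ ≤ 1} := ⟨⟨0, by simp⟩⟩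
  exact ciSup_le fun φ => h φ.1 φ.2

theorem weakLpNorm_nonneg (p : ℝ) (x : Fin N → E) : 0 ≤ weakLpNorm 𝕜 p x :=
  Real.iSup_nonneg fun _ => Real.rpow_nonneg
    (Finset.sum_nonneg fun _ _ => Real.rpow_nonneg (norm_nonneg _) _) _

theorem norm_sum_smul_le_weakLpNorm_one (x : Fin N → E) {c : Fin N → 𝕜} {t : ℝ}
    (hc : ∀ j, ‖c j‖ ≤ t) : ‖∑ j, c j • x j‖ ≤ weakLpNorm 𝕜 1 x * t := by
  obtain ⟨φ, hφ, h⟩ := exists_dual_vector'' 𝕜 (∑ j, c j • x j)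
  have h1 : ∑ j, ‖φ (x j)‖ ≤ weakLpNorm 𝕜 1 x := by
    simpa using le_weakLpNorm le_rfl x hφ
  calc ‖∑ j, c j • x j‖ = ‖φ (∑ j, c j • x j)‖ := by rw [h]; simp
    _ = ‖∑ j, c j * φ (x j)‖ := by simp [map_sum]
    _ ≤ ∑ j, ‖c j‖ * ‖φ (x j)‖ := (norm_sum_le _ _).trans_eq (by simp)
    _ ≤ ∑ j, t * ‖φ (x j)‖ := by gcongr with j _; exact hc j
    _ = (∑ j, ‖φ (x j)‖) * t := by rw [← Finset.mul_sum, mul_comm]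
    _ ≤ weakLpNorm 𝕜 1 x * t := by
        rcases Nat.eq_zero_or_pos N with rfl | hN
        · simp [show weakLpNorm 𝕜 1 x = 0 from le_antisymm (weakLpNorm_le (by simp))
            (weakLpNorm_nonneg _ _)]
        · have : 0 ≤ t := (norm_nonneg _).trans (hc ⟨0, hN⟩)
          gcongr

/-- The converse of Hölder's inequality for finite families of scalars. -/
theorem rpow_sum_le_of_forall_norm_sum_mul_le {r s : ℝ} (hrs : r.HolderConjugate s) (d : Fin N → 𝕜)
    {M : ℝ} (hM : 0 ≤ M)
    (h : ∀ c : Fin N → 𝕜, ‖∑ j, c j * d j‖ ≤ M * (∑ j, ‖c j‖ ^ s) ^ (1 / s)) :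
    (∑ j, ‖d j‖ ^ r) ^ (1 / r) ≤ M := by
  have hr0 := hrs.pos
  have hs0 := hrs.symm.pos
  set S := ∑ j, ‖d j‖ ^ r with hS
  have hS0 : 0 ≤ S := Finset.sum_nonneg fun _ _ => by positivity
  rcases hS0.eq_or_lt with h0 | hSpos
  · rw [← h0, Real.zero_rpow (by simpa using hr0.ne')]
    exact hM
  -- The extremal sequence: `c j * d j = ‖d j‖ ^ r` and `‖c j‖ ^ s = ‖d j‖ ^ r`, also if `d j = 0`.
  let c : Fin N → 𝕜 := fun j => ((‖d j‖ ^ (r - 2) : ℝ) : 𝕜) * (starRingEnd 𝕜) (d j)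
  have hcd (j : Fin N) : c j * d j = ((‖d j‖ ^ r : ℝ) : 𝕜) := by
    simp only [c, mul_assoc, RCLike.conj_mul]
    rcases (norm_nonneg (d j)).eq_or_lt with h | h
    · rw [← h, Real.zero_rpow hr0.ne']; simp
    · rw [← RCLike.ofReal_pow, ← RCLike.ofReal_mul, ← Real.rpow_natCast, ← Real.rpow_add h]
      norm_num
  have hc (j : Fin N) : ‖c j‖ ^ s = ‖d j‖ ^ r := by
    simp only [c, norm_mul, RCLike.norm_conj, RCLike.norm_ofReal]
    rw [abs_of_nonneg (by positivity)]
    rcases (norm_nonneg (d j)).eq_or_lt with h | h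
    · rw [← h, mul_zero, Real.zero_rpow hr0.ne', Real.zero_rpow hs0.ne']
    · rw [← Real.rpow_add_one h.ne', ← Real.rpow_mul h.le]
      congr 1
      have := hrs.sub_one_mul_conj
      linarith
  have h1 := h c
  simp only [hcd, hc, ← hS] at h1
  rw [← RCLike.ofReal_sum, RCLike.norm_ofReal, abs_of_nonneg hS0] at h1
  have h2 : S = S ^ (1 / r) * S ^ (1 / s) := by
    rw [← Real.rpow_add hSpos, one_div, one_div, hrs.inv_add_inv_eq_one, Real.rpow_one]
  have h3 : 0 < S ^ (1 / s) := by positivity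
  refine le_of_mul_le_mul_right ?_ h3
  rw [← h2]
  exact h1

end WeakNorm

/-! ### Weakly summable families in spaces of cotype two -/

section Cotype

variable {E : Type*} [NormedAddCommGroup E]

theorem HasCotype.exists_sum_sq_le (hE : HasCotype 2 E) :
    ∃ C : ℝ, 0 ≤ C ∧ ∀ (m : ℕ) (x : Fin m → E), ∑ j, ‖x j‖ ^ 2 ≤
      C * ((∑ ε : Fin m → ℤˣ, ‖∑ j, ((ε j : ℤˣ) : ℤ) • x j‖ ^ 2) / 2 ^ m) := by
  obtain ⟨C, hC, h⟩ := hE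
  refine ⟨C ^ 2, sq_nonneg C, fun m x => ?_⟩
  have := h m x
  simp only [Real.rpow_ofNat, ← Real.sqrt_eq_rpow] at this
  have h2 : 0 ≤ (∑ ε : Fin m → ℤˣ, ‖∑ j, ((ε j : ℤˣ) : ℤ) • x j‖ ^ 2) / 2 ^ m := by positivity
  have h1 : 0 ≤ ∑ j, ‖x j‖ ^ 2 := by positivity
  calc ∑ j, ‖x j‖ ^ 2 = √(∑ j, ‖x j‖ ^ 2) ^ 2 := (Real.sq_sqrt h1).symm
    _ ≤ (C * √((∑ ε : Fin m → ℤˣ, ‖∑ j, ((ε j : ℤˣ) : ℤ) • x j‖ ^ 2) / 2 ^ m)) ^ 2 := by gcongr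
    _ = _ := by rw [mul_pow, Real.sq_sqrt h2]

/-- The domination theorem for the operator `c ↦ ∑ j, c j • x j` on `ℓ_∞^N`, whose norm is at most
the weak `ℓ_1` norm of `x`. -/
theorem HasCotype.exists_weight (𝕜 : Type*) [RCLike 𝕜] [NormedSpace 𝕜 E] (hE : HasCotype 2 E) :
    ∃ K : ℝ, 0 ≤ K ∧ ∀ (N : ℕ) (x : Fin N → E), ∃ μ : Fin N → ℝ, (∀ j, 0 ≤ μ j) ∧ ∑ j, μ j ≤ 1 ∧
      ∀ c : Fin N → 𝕜, ‖∑ j, c j • x j‖ ≤ K * weakLpNorm 𝕜 1 x * √(∑ j, μ j * ‖c j‖ ^ 2) := by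
  obtain ⟨C, hC, h⟩ := hE.exists_sum_sq_le
  let _ : NormedSpace ℝ E := NormedSpace.restrictScalars ℝ 𝕜 E
  have hsmul (t : ℝ) (v : E) : t • v = (t : 𝕜) • v := by
    rw [← RCLike.algebraMap_eq_ofReal]; rfl
  refine ⟨2 * √(48 * C ^ 2 + 1), by positivity, fun N x => ?_⟩
  set w := weakLpNorm 𝕜 1 x with hw
  rcases (show 0 ≤ w from weakLpNorm_nonneg 1 x).eq_or_lt with h0 | hpos
  · refine ⟨0, by simp, by simp, fun c => ?_⟩
    have := norm_sum_smul_le_weakLpNorm_one x (c := c) (t := ∑ j, ‖c j‖)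
      fun j => Finset.single_le_sum (f := fun j => ‖c j‖) (fun _ _ => norm_nonneg _)
        (Finset.mem_univ j)
    rw [← hw, ← h0, zero_mul] at this
    refine this.trans (by simp)
  let T : (Fin N → ℝ) →ₗ[ℝ] E := w⁻¹ • Fintype.linearCombination ℝ x
  have hTnorm (f : Fin N → ℝ) : ‖∑ j, (f j : 𝕜) • x j‖ = w * ‖T f‖ := by
    simp only [T, LinearMap.smul_apply, Fintype.linearCombination_apply, hsmul, norm_smul,
      RCLike.norm_ofReal, abs_of_pos (inv_pos.2 hpos)]
    field_simp
  have hT (f : Fin N → ℝ) (t : ℝ) (ht : ∀ j, |f j| ≤ t) : ‖T f‖ ≤ t := by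
    have := norm_sum_smul_le_weakLpNorm_one x (c := fun j => (f j : 𝕜)) (t := t)
      (by simpa using ht)
    rw [hTnorm] at this
    exact le_of_mul_le_mul_left this hpos
  obtain ⟨μ, hμ, hμ1, hμT⟩ := exists_weight_of_cotype_two hC h T hT
  refine ⟨μ, hμ, hμ1, fun c => ?_⟩
  have hreal (f : Fin N → ℝ) (hf : ∀ j, |f j| ≤ ‖c j‖) : ‖∑ j, (f j : 𝕜) • x j‖ ≤
      √(48 * C ^ 2 + 1) * w * √(∑ j, μ j * ‖c j‖ ^ 2) := by
    have h1 : ‖T f‖ ≤ √((48 * C ^ 2 + 1) * ∑ j, μ j * ‖c j‖ ^ 2) := by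
      refine Real.le_sqrt_of_sq_le ((hμT f).trans ?_)
      refine mul_le_mul_of_nonneg_left (Finset.sum_le_sum fun j _ =>
        mul_le_mul_of_nonneg_left ?_ (hμ j)) (by positivity)
      rw [← sq_abs]
      exact pow_le_pow_left₀ (abs_nonneg _) (hf j) 2
    rw [hTnorm]
    calc w * ‖T f‖ ≤ w * √((48 * C ^ 2 + 1) * ∑ j, μ j * ‖c j‖ ^ 2) := by gcongr
      _ = _ := by rw [Real.sqrt_mul (by positivity)]; ring
  have hsplit : ∑ j, c j • x j = ∑ j, ((RCLike.re (c j) : ℝ) : 𝕜) • x j +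
      (RCLike.I : 𝕜) • ∑ j, ((RCLike.im (c j) : ℝ) : 𝕜) • x j := by
    rw [Finset.smul_sum, ← Finset.sum_add_distrib]
    refine Finset.sum_congr rfl fun j _ => ?_
    rw [smul_smul, ← add_smul, mul_comm, RCLike.re_add_im]
  rw [hsplit]
  have h1 := hreal _ fun j => RCLike.abs_re_le_norm (c j)
  have h2 := hreal _ fun j => RCLike.abs_im_le_norm (c j)
  have hI : ‖(RCLike.I : 𝕜)‖ ≤ 1 := by
    rcases RCLike.I_eq_zero_or_im_I_eq_one (K := 𝕜) with h | h
    · simp [h]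
    · exact (RCLike.norm_I_of_ne_zero (fun h0 => by simp [h0] at h)).le
  calc _ ≤ ‖∑ j, ((RCLike.re (c j) : ℝ) : 𝕜) • x j‖ +
        ‖(RCLike.I : 𝕜)‖ * ‖∑ j, ((RCLike.im (c j) : ℝ) : 𝕜) • x j‖ := by
        rw [← norm_smul]; exact norm_add_le _ _
    _ ≤ ‖∑ j, ((RCLike.re (c j) : ℝ) : 𝕜) • x j‖ +
        1 * ‖∑ j, ((RCLike.im (c j) : ℝ) : 𝕜) • x j‖ := by gcongr
    _ ≤ _ := by linarith

/-- In a space of cotype two a weakly `1`-summable family is the product of an `ℓ_s` sequence and a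
weakly `r`-summable family, for conjugate exponents `r < 2 < s`: with the dominating weight `μ`
of `HasCotype.exists_weight`, the scalars are `a j = μ j ^ (1 / s)`. -/
theorem HasCotype.exists_smul_factorization (𝕜 : Type*) [RCLike 𝕜] [NormedSpace 𝕜 E]
    (hE : HasCotype 2 E) {r s : ℝ} (hrs : r.HolderConjugate s) (hs : 2 < s) :
    ∃ K : ℝ, 0 ≤ K ∧ ∀ (N : ℕ) (x : Fin N → E), ∃ (a : Fin N → ℝ) (y : Fin N → E),
      (∀ j, 0 ≤ a j) ∧ ∑ j, a j ^ s ≤ 1 ∧ (∀ j, x j = (a j : 𝕜) • y j) ∧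
        weakLpNorm 𝕜 r y ≤ K * weakLpNorm 𝕜 1 x := by
  obtain ⟨K, hK, h⟩ := hE.exists_weight 𝕜
  have hs0 : 0 < s := by linarith
  refine ⟨K, hK, fun N x => ?_⟩
  obtain ⟨μ, hμ, hμ1, hx⟩ := h N x
  have ha0 (j : Fin N) : 0 ≤ μ j ^ (1 / s) := Real.rpow_nonneg (hμ j) _
  refine ⟨fun j => μ j ^ (1 / s), fun j => (((μ j ^ (1 / s))⁻¹ : ℝ) : 𝕜) • x j, ha0, ?_,
    fun j => ?_, weakLpNorm_le fun φ hφ => ?_⟩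
  · refine le_trans (le_of_eq ?_) hμ1
    refine Finset.sum_congr rfl fun j _ => ?_
    rw [← Real.rpow_mul (hμ j), one_div_mul_cancel hs0.ne', Real.rpow_one]
  · rcases (hμ j).eq_or_lt with h0 | hpos
    -- Where `μ` vanishes, the domination applied to the unit vector `e_j` forces `x j = 0`.
    · have h1 := hx (Pi.single j 1)
      have h2 : ∑ i, μ i * ‖(Pi.single j 1 : Fin N → 𝕜) i‖ ^ 2 = 0 := by
        refine Finset.sum_eq_zero fun i _ => ?_
        by_cases hij : i = j
        · rw [hij, ← h0, zero_mul]
        · simp [hij]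
      rw [h2, Finset.sum_eq_single j (fun i _ hij => by simp [hij]) (by simp)] at h1
      have hxj : x j = 0 := by simpa using h1
      simp [hxj]
    · have h1 : μ j ^ (1 / s) ≠ 0 := by positivity
      rw [smul_smul, ← RCLike.ofReal_mul, mul_inv_cancel₀ h1, RCLike.ofReal_one, one_smul]
  · refine rpow_sum_le_of_forall_norm_sum_mul_le hrs _
      (mul_nonneg hK (weakLpNorm_nonneg 1 x)) fun c => ?_
    have hφx : ∑ j, c j * φ ((((μ j ^ (1 / s))⁻¹ : ℝ) : 𝕜) • x j) =
        φ (∑ j, (c j * (((μ j ^ (1 / s))⁻¹ : ℝ) : 𝕜)) • x j) := by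
      simp [map_sum, mul_assoc]
    rw [hφx]
    refine ((φ.le_of_opNorm_le hφ _).trans_eq (one_mul _)).trans ((hx _).trans ?_)
    refine mul_le_mul_of_nonneg_left ?_ (mul_nonneg hK (weakLpNorm_nonneg 1 x))
    have ha : 0 < 2 / s := by positivity
    have ha1 : 2 / s < 1 := (div_lt_one hs0).2 hs
    have hterm (j : Fin N) : μ j * ‖c j * (((μ j ^ (1 / s))⁻¹ : ℝ) : 𝕜)‖ ^ 2 ≤
        μ j ^ (1 - 2 / s) * ‖c j‖ ^ 2 := by
      rw [norm_mul, mul_pow, RCLike.norm_ofReal, sq_abs]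
      rcases (hμ j).eq_or_lt with h0 | hpos
      · rw [← h0, zero_mul]; positivity
      · have : μ j * ((μ j ^ (1 / s))⁻¹) ^ 2 = μ j ^ (1 - 2 / s) := by
          rw [inv_pow, ← Real.rpow_natCast, ← Real.rpow_mul hpos.le, Real.rpow_sub hpos,
            Real.rpow_one, div_eq_mul_inv]
          congr 3
          push_cast; ring
        rw [← this]
        exact le_of_eq (by ring)
    have hH := Real.inner_le_Lp_mul_Lq_of_nonneg Finset.univ
      (Real.HolderConjugate.one_sub_inv_inv ha ha1) (f := fun j => μ j ^ (1 - 2 / s))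
      (g := fun j => ‖c j‖ ^ 2) (fun j _ => Real.rpow_nonneg (hμ j) _) (fun j _ => sq_nonneg _)
    have e1 (j : Fin N) : (μ j ^ (1 - 2 / s)) ^ (1 - 2 / s)⁻¹ = μ j :=
      Real.rpow_rpow_inv (hμ j) (by linarith)
    have e2 (j : Fin N) : (‖c j‖ ^ 2) ^ (2 / s)⁻¹ = ‖c j‖ ^ s := by
      rw [← Real.rpow_natCast, ← Real.rpow_mul (norm_nonneg _)]
      congr 1
      push_cast; field_simp
    simp only [e1, e2, one_div, inv_inv] at hH
    have h0 : 0 ≤ ∑ j, ‖c j‖ ^ s := Finset.sum_nonneg fun _ _ => by positivity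
    have h1 : (∑ j, μ j) ^ (1 - 2 / s) ≤ 1 :=
      Real.rpow_le_one (Finset.sum_nonneg fun j _ => hμ j) hμ1 (by linarith)
    calc √(∑ j, μ j * ‖c j * (((μ j ^ (1 / s))⁻¹ : ℝ) : 𝕜)‖ ^ 2)
        ≤ √((∑ j, ‖c j‖ ^ s) ^ (2 / s)) := by
          refine Real.sqrt_le_sqrt ((Finset.sum_le_sum fun j _ => hterm j).trans (hH.trans ?_))
          exact mul_le_of_le_one_left (by positivity) h1
      _ = (∑ j, ‖c j‖ ^ s) ^ (1 / s) := by
          rw [Real.sqrt_eq_rpow, ← Real.rpow_mul h0]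
          congr 1
          ring

end Cotype

/-! ### Averages over products of finite probability spaces -/

section ProductWeights

variable {Ω : Type*} [Fintype Ω] {N : ℕ} {q : Ω → ℝ}

theorem sum_prod_weight_mul (q : Ω → ℝ) (g : Fin N → Ω → ℝ) :
    ∑ ω : Fin N → Ω, (∏ i, q (ω i)) * ∏ i, g i (ω i) = ∏ i, ∑ l, q l * g i l := by
  classical
  rw [Finset.prod_univ_sum]
  simp [Finset.prod_mul_distrib]

theorem sum_prod_weight (hq1 : ∑ l, q l = 1) : ∑ ω : Fin N → Ω, ∏ i, q (ω i) = 1 := by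
  simpa [hq1] using sum_prod_weight_mul (N := N) q fun _ _ => 1

theorem sum_prod_weight_marginal (hq1 : ∑ l, q l = 1) (j : Fin N) (g : Ω → ℝ) :
    ∑ ω : Fin N → Ω, (∏ i, q (ω i)) * g (ω j) = ∑ l, q l * g l := by
  have := sum_prod_weight_mul q fun i l => if i = j then g l else 1
  have h1 (ω : Fin N → Ω) : (∏ i, if i = j then g (ω i) else 1) = g (ω j) := by simp
  simp only [h1] at this
  rw [this, Finset.prod_eq_single j]
  · simp
  · intro i _ hij
    simp [hij, hq1]
  · simp

/-- For `∑ |c j| ^ r ≤ 1` the randomly signed sum `∑ ± t (ω j) c j` is bounded in mean; only the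
truncated moments of `t` enter, since `(∑ y j ^ 2) ^ (1 / 2) ≤ 1 + ∑ min (y j ^ 2) |y j|`. -/
theorem sum_prod_weight_abs_sum_sign_le (hq : ∀ l, 0 ≤ q l) (hq1 : ∑ l, q l = 1) {t : Ω → ℝ}
    (ht : ∀ l, 0 ≤ t l) {r K : ℝ} (hK : 0 ≤ K)
    (h : ∀ y, 0 ≤ y → ∑ l, q l * min ((y * t l) ^ 2) (y * t l) ≤ K * y ^ r)
    (c : Fin N → ℝ) (hc : ∑ j, |c j| ^ r ≤ 1) :
    ∑ ω : Fin N → Ω, (∏ i, q (ω i)) *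
      ((2 ^ N)⁻¹ * ∑ ε : Fin N → ℤˣ, |∑ j, ((ε j : ℤ) : ℝ) * (t (ω j) * c j)|) ≤ 1 + K := by
  have hsign (y : Fin N → ℝ) : (2 ^ N)⁻¹ * ∑ ε : Fin N → ℤˣ, |∑ j, ((ε j : ℤ) : ℝ) * y j| ≤
      √(∑ j, y j ^ 2) := by
    refine Real.le_sqrt_of_sq_le ?_
    have := sq_sum_le_card_mul_sum_sq (s := (Finset.univ : Finset (Fin N → ℤˣ)))
      (f := fun ε => |∑ j, ((ε j : ℤ) : ℝ) * y j|)
    simp only [sq_abs, sum_sign_sq] at this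
    simp only [Finset.card_univ, Fintype.card_pi, Fintype.card_units_int, Finset.prod_const,
      Fintype.card_fin, Nat.cast_pow, Nat.cast_ofNat] at this
    rw [mul_pow, inv_pow, inv_mul_le_iff₀ (by positivity)]
    linarith
  have hsqrt (y : Fin N → ℝ) : √(∑ j, y j ^ 2) ≤ 1 + ∑ j, min (|y j| ^ 2) |y j| := by
    set G := ∑ j, min (|y j| ^ 2) |y j| with hG
    have hm (j : Fin N) : 0 ≤ min (|y j| ^ 2) |y j| := by positivity
    have hG0 : 0 ≤ G := Finset.sum_nonneg fun j _ => hm j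
    refine Real.sqrt_le_iff.2 ⟨by linarith, ?_⟩
    have h1 (j : Fin N) : y j ^ 2 ≤ min (|y j| ^ 2) |y j| + min (|y j| ^ 2) |y j| ^ 2 := by
      rw [← sq_abs (y j)]
      rcases min_choice (|y j| ^ 2) |y j| with h | h <;> rw [h]
      · exact le_add_of_nonneg_right (sq_nonneg _)
      · exact le_add_of_nonneg_left (abs_nonneg _)
    have h2 : ∑ j, min (|y j| ^ 2) |y j| ^ 2 ≤ G ^ 2 :=
      Finset.sum_sq_le_sq_sum_of_nonneg fun j _ => hm j
    calc ∑ j, y j ^ 2 ≤ ∑ j, (min (|y j| ^ 2) |y j| + min (|y j| ^ 2) |y j| ^ 2) :=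
          Finset.sum_le_sum fun j _ => h1 j
      _ ≤ G + G ^ 2 := by rw [Finset.sum_add_distrib]; linarith
      _ ≤ (1 + G) ^ 2 := by nlinarith
  calc _ ≤ ∑ ω : Fin N → Ω, (∏ i, q (ω i)) *
          (1 + ∑ j, min ((|c j| * t (ω j)) ^ 2) (|c j| * t (ω j))) := by
        gcongr with ω _
        · exact Finset.prod_nonneg fun i _ => hq _
        · refine (hsign _).trans ((hsqrt _).trans_eq ?_)
          simp only [abs_mul, abs_of_nonneg (ht _), mul_comm]
    _ = 1 + ∑ j, ∑ l, q l * min ((|c j| * t l) ^ 2) (|c j| * t l) := by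
        simp only [mul_add, mul_one, Finset.sum_add_distrib, sum_prod_weight hq1, Finset.mul_sum]
        rw [Finset.sum_comm]
        congr 1
        exact Finset.sum_congr rfl fun j _ => sum_prod_weight_marginal hq1 j
          fun l => min ((|c j| * t l) ^ 2) (|c j| * t l)
    _ ≤ 1 + ∑ j, K * |c j| ^ r := by
        gcongr with j _
        exact h _ (abs_nonneg _)
    _ ≤ 1 + K := by
        rw [← Finset.mul_sum]
        nlinarith

/-- The randomly signed sum `∑ ± t (ω j) z j` dominates each of its terms in mean, so its mean
norm is at least the probability that one of the independent events `1 ≤ t (ω j) * ‖z j‖` occurs. -/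
theorem one_sub_exp_le_sum_prod_weight (𝕜 : Type*) [RCLike 𝕜] {G : Type*} [NormedAddCommGroup G]
    [NormedSpace 𝕜 G] (hq : ∀ l, 0 ≤ q l) (hq1 : ∑ l, q l = 1) {t : Ω → ℝ} (ht : ∀ l, 0 ≤ t l)
    (z : Fin N → G) :
    1 - Real.exp (-∑ j, ∑ l, q l * (if 1 ≤ t l * ‖z j‖ then 1 else 0)) ≤
      ∑ ω : Fin N → Ω, (∏ i, q (ω i)) *
        ((2 ^ N)⁻¹ * ∑ ε : Fin N → ℤˣ, ‖∑ j, ((ε j : ℤˣ) : ℤ) • ((t (ω j) : ℝ) : 𝕜) • z j‖) := by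
  let _ : NormedSpace ℝ G := NormedSpace.restrictScalars ℝ 𝕜 G
  let g : Fin N → Ω → ℝ := fun j l => if 1 ≤ t l * ‖z j‖ then 1 else 0
  have hg (j : Fin N) (l : Ω) : g j l = 1 ∨ g j l = 0 := by simp only [g]; split_ifs <;> simp
  have hmass (ω : Fin N → Ω) : 0 ≤ ∏ i, q (ω i) := Finset.prod_nonneg fun i _ => hq _
  have hpoint (ω : Fin N → Ω) : 1 - ∏ j, (1 - g j (ω j)) ≤
      (2 ^ N)⁻¹ * ∑ ε : Fin N → ℤˣ, ‖∑ j, ((ε j : ℤˣ) : ℤ) • ((t (ω j) : ℝ) : 𝕜) • z j‖ := by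
    by_cases hex : ∃ j, 1 ≤ t (ω j) * ‖z j‖
    · obtain ⟨j, hj⟩ := hex
      have h1 : 0 ≤ ∏ j, (1 - g j (ω j)) := Finset.prod_nonneg fun j _ => by
        rcases hg j (ω j) with h | h <;> simp [h]
      have h2 := norm_le_sum_sign (fun j => ((t (ω j) : ℝ) : 𝕜) • z j) j
      rw [norm_smul, RCLike.norm_ofReal, abs_of_nonneg (ht _)] at h2
      rw [le_inv_mul_iff₀ (by positivity)]
      refine le_trans ?_ h2
      gcongr
      linarith
    · have h1 : ∏ j, (1 - g j (ω j)) = 1 := Finset.prod_eq_one fun j _ => by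
        simp only [g]; rw [if_neg (fun h => hex ⟨j, h⟩), sub_zero]
      rw [h1, sub_self]
      positivity
  have hexp : ∏ j, (1 - ∑ l, q l * g j l) ≤ Real.exp (-∑ j, ∑ l, q l * g j l) := by
    rw [← Finset.sum_neg_distrib, Real.exp_sum]
    refine Finset.prod_le_prod (fun j _ => ?_) fun j _ => Real.one_sub_le_exp_neg _
    rw [← hq1, sub_nonneg]
    refine Finset.sum_le_sum fun l _ => mul_le_of_le_one_right (hq l) ?_
    rcases hg j l with h | h <;> simp [h]
  calc 1 - Real.exp (-∑ j, ∑ l, q l * g j l) ≤ 1 - ∏ j, (1 - ∑ l, q l * g j l) := by linarith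
    _ = ∑ ω : Fin N → Ω, (∏ i, q (ω i)) * (1 - ∏ j, (1 - g j (ω j))) := by
        simp only [mul_sub, mul_one, Finset.sum_sub_distrib, sum_prod_weight hq1,
          sum_prod_weight_mul q (fun j l => 1 - g j l), hq1]
    _ ≤ _ := Finset.sum_le_sum fun ω _ => mul_le_mul_of_nonneg_left (hpoint ω) (hmass ω)

end ProductWeights

/-! ### Coefficient matrices with stable behaviour -/

/-- The truncated moments of a variable which equals `2 ^ k` with probability about `2 ^ (-r * k)`
are at most `K * y ^ r`, for `1 < r < 2`. -/
theorem exists_sum_pow_mul_min_le {r : ℝ} (hr1 : 1 < r) (hr2 : r < 2) :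
    ∃ K : ℝ, 0 ≤ K ∧ ∀ (L : ℕ) (y : ℝ), 0 ≤ y →
      ∑ k ∈ Finset.range L, ((2 : ℝ) ^ (-r)) ^ k * min ((y * 2 ^ k) ^ 2) (y * 2 ^ k) ≤
        K * y ^ r := by
  set ρ : ℝ := (2 : ℝ) ^ (-r) with hρ
  have hρ0 : 0 < ρ := by positivity
  have hρ2 : 2 * ρ < 1 := by
    have : ρ < (2 : ℝ) ^ (-1 : ℝ) := Real.rpow_lt_rpow_of_exponent_lt (by norm_num) (by linarith)
    rw [Real.rpow_neg_one] at this
    linarith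
  have hρ4 : 1 < 4 * ρ := by
    have : (2 : ℝ) ^ (-2 : ℝ) < ρ := Real.rpow_lt_rpow_of_exponent_lt (by norm_num) (by linarith)
    rw [Real.rpow_neg (by norm_num), Real.rpow_ofNat] at this
    linarith
  have hρy (y : ℝ) (hy : 0 ≤ y) : ρ * (2 * y) ^ r = y ^ r := by
    rw [Real.mul_rpow (by norm_num) hy, ← mul_assoc, hρ, ← Real.rpow_add (by norm_num),
      neg_add_cancel, Real.rpow_zero, one_mul]
  set D : ℝ := (1 - 2 * ρ)⁻¹ with hD
  set D' : ℝ := (4 * ρ - 1)⁻¹ with hD'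
  have hD0 : 0 < D := inv_pos.2 (by linarith)
  have hD'0 : 0 < D' := inv_pos.2 (by linarith)
  have hDeq : D * (1 - 2 * ρ) = 1 := inv_mul_cancel₀ (by linarith)
  have hD'eq : D' * (4 * ρ - 1) = 1 := inv_mul_cancel₀ (by linarith)
  set K : ℝ := 4 * (D' + 1 + D) with hK
  -- `Φ` satisfies `min (y ^ 2) y + ρ * Φ (2 * y) ≤ Φ y`, so it dominates all partial sums.
  let Φ : ℝ → ℝ := fun y => if y ≤ 1 then K * y ^ r - D' * y ^ 2 else D * y
  have hsq (y : ℝ) (h0 : 0 ≤ y) (h1 : y ≤ 1) : y ^ 2 ≤ y ^ r := by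
    rw [← Real.rpow_ofNat]
    rcases h0.eq_or_lt with h | h
    · rw [← h, Real.zero_rpow (by norm_num), Real.zero_rpow (by linarith)]
    · exact Real.rpow_le_rpow_of_exponent_ge h h1 hr2.le
  have hstep (y : ℝ) (hy : 0 ≤ y) : min (y ^ 2) y + ρ * Φ (2 * y) ≤ Φ y := by
    by_cases h1 : y ≤ 1
    · by_cases h2 : 2 * y ≤ 1
      · simp only [Φ, if_pos h1, if_pos h2]
        have h3 : ρ * (K * (2 * y) ^ r - D' * (2 * y) ^ 2) =
            K * y ^ r - D' * (4 * ρ - 1) * y ^ 2 - D' * y ^ 2 := by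
          rw [← hρy y hy]; ring
        rw [h3, hD'eq]
        have := min_le_left (y ^ 2) y
        linarith
      · simp only [Φ, if_pos h1, if_neg h2]
        have h3 : 1 / 4 ≤ y ^ r := by
          refine le_trans ?_ (hsq y hy h1)
          nlinarith
        have h4 : K * (1 / 4) ≤ K * y ^ r := by gcongr
        have h5 : y ^ 2 ≤ 1 := by nlinarith
        have h6 : D' * y ^ 2 ≤ D' := by nlinarith
        have h7 : ρ * (D * (2 * y)) ≤ D := by nlinarith [mul_pos hρ0 hD0]
        have := min_le_left (y ^ 2) y
        linarith
    · have h2 : ¬ 2 * y ≤ 1 := by linarith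
      simp only [Φ, if_neg h1, if_neg h2]
      have := min_le_right (y ^ 2) y
      have h3 : ρ * (D * (2 * y)) = D * y - D * (1 - 2 * ρ) * y := by ring
      rw [h3, hDeq]
      linarith
  have hΦ0 (y : ℝ) (hy : 0 ≤ y) : 0 ≤ Φ y := by
    by_cases h1 : y ≤ 1
    · simp only [Φ, if_pos h1]
      have h2 := hsq y hy h1
      have h3 : D' * y ^ 2 ≤ K * y ^ r := by
        have : D' ≤ K := by linarith
        gcongr
      linarith
    · simp only [Φ, if_neg h1]; positivity
  have hΦ (L : ℕ) : ∀ y, 0 ≤ y →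
      ∑ k ∈ Finset.range L, ρ ^ k * min ((y * 2 ^ k) ^ 2) (y * 2 ^ k) ≤ Φ y := by
    induction L with
    | zero => intro y hy; simpa using hΦ0 y hy
    | succ L ih =>
      intro y hy
      rw [Finset.sum_range_succ']
      have h1 : ∑ k ∈ Finset.range L, ρ ^ (k + 1) *
          min ((y * 2 ^ (k + 1)) ^ 2) (y * 2 ^ (k + 1)) =
          ρ * ∑ k ∈ Finset.range L, ρ ^ k * min ((2 * y * 2 ^ k) ^ 2) (2 * y * 2 ^ k) := by
        rw [Finset.mul_sum]
        refine Finset.sum_congr rfl fun k _ => ?_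
        rw [show y * 2 ^ (k + 1) = 2 * y * 2 ^ k by ring]
        ring
      rw [h1]
      have h2 := mul_le_mul_of_nonneg_left (ih (2 * y) (by positivity)) hρ0.le
      have h3 := hstep y hy
      simp only [pow_zero, mul_one, one_mul]
      linarith
  refine ⟨K, by positivity, fun L y hy => (hΦ L y hy).trans ?_⟩
  by_cases h1 : y ≤ 1
  · simp only [Φ, if_pos h1]
    have : 0 ≤ D' * y ^ 2 := by positivity
    linarith
  · simp only [Φ, if_neg h1]
    have h2 : y ≤ y ^ r := Real.self_le_rpow_of_one_le (by linarith) hr1.le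
    have h3 : D ≤ K := by linarith
    gcongr

/-- Finitely many vectors `a i` in `ℝ ^ N` on which every linear form `c` has `ℓ_1` norm at most
`K * ‖c‖_r`, while vector valued forms `z` have `ℓ_1` norm at least `K⁻¹ * (∑ ‖z j‖ ^ r) ^ (1 / r)`,
with `K` independent of `N`. They are the weighted values of a vector of independent symmetric
random variables with tails `P(|θ| ≥ t) ≈ t ^ (-r)`, cut off at the height `2 ^ (N + 1)`. -/
theorem exists_stable_coefficients.{u} (𝕜 : Type*) [RCLike 𝕜] {r : ℝ} (hr1 : 1 < r) (hr2 : r < 2) :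
    ∃ K : ℝ, 0 ≤ K ∧ ∀ N : ℕ, ∃ (L : ℕ) (a : Fin L → Fin N → ℝ),
      (∀ c : Fin N → ℝ, ∑ i, |∑ j, a i j * c j| ≤ K * (∑ j, |c j| ^ r) ^ (1 / r)) ∧
      ∀ (G : Type u) [NormedAddCommGroup G] [NormedSpace 𝕜 G] (z : Fin N → G),
        (∑ j, ‖z j‖ ^ r) ^ (1 / r) ≤ K * ∑ i, ‖∑ j, (a i j : 𝕜) • z j‖ := by
  obtain ⟨K, hK, hmin⟩ := exists_sum_pow_mul_min_le hr1 hr2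
  set ρ : ℝ := (2 : ℝ) ^ (-r) with hρ
  have hρ0 : 0 < ρ := by positivity
  have hρ2 : ρ ≤ 1 / 2 := by
    have : ρ ≤ (2 : ℝ) ^ (-1 : ℝ) := Real.rpow_le_rpow_of_exponent_le (by norm_num) (by linarith)
    rw [Real.rpow_neg_one] at this
    linarith
  have hr0 : 0 < r := by linarith
  set κ : ℝ := 1 - Real.exp (-(1 / 8)) with hκ
  have hκ0 : 0 < κ := by
    have : Real.exp (-(1 / 8)) < 1 := by
      rw [← Real.exp_zero]
      exact Real.exp_lt_exp.2 (by norm_num)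
    linarith
  refine ⟨max (1 + K) κ⁻¹, by positivity, fun N => ?_⟩
  let L := N + 1
  -- The value `2 ^ (l + 1)` has probability `2 ^ (-r * (l + 1))`, and `0` has the remaining mass.
  let q : Option (Fin L) → ℝ := fun o =>
    o.elim (1 - ∑ l : Fin L, ρ ^ ((l : ℕ) + 1)) fun l => ρ ^ ((l : ℕ) + 1)
  let t : Option (Fin L) → ℝ := fun o => o.elim 0 fun l => 2 ^ ((l : ℕ) + 1)
  have hq1 : ∑ o, q o = 1 := by simp [q, Fintype.sum_option]
  have hq : ∀ o, 0 ≤ q o := by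
    rintro (_ | l)
    · have h1 (n : ℕ) : ∑ l ∈ Finset.range n, ρ ^ (l + 1) ≤ 1 - (1 / 2) ^ n := by
        induction n with
        | zero => simp
        | succ n ih =>
          rw [Finset.sum_range_succ]
          have : ρ ^ (n + 1) ≤ (1 / 2) ^ (n + 1) := by gcongr
          rw [pow_succ (1 / 2 : ℝ)] at this ⊢
          linarith
      have h2 := h1 L
      rw [← Fin.sum_univ_eq_sum_range (fun l => ρ ^ (l + 1))] at h2
      have h3 : (0 : ℝ) < (1 / 2) ^ L := by positivity
      simp only [q, Option.elim]
      linarith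
    · simp only [q, Option.elim]; positivity
  have ht : ∀ o, 0 ≤ t o := by
    rintro (_ | l)
    · simp [t]
    · simp only [t, Option.elim]; positivity
  have hρr (y : ℝ) (hy : 0 ≤ y) : ρ * (2 * y) ^ r = y ^ r := by
    rw [Real.mul_rpow (by norm_num) hy, ← mul_assoc, hρ, ← Real.rpow_add (by norm_num),
      neg_add_cancel, Real.rpow_zero, one_mul]
  have hmoment (y : ℝ) (hy : 0 ≤ y) : ∑ o, q o * min ((y * t o) ^ 2) (y * t o) ≤ K * y ^ r := by
    have h1 := mul_le_mul_of_nonneg_left (hmin L (2 * y) (by positivity)) hρ0.le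
    rw [show ρ * (K * (2 * y) ^ r) = K * (ρ * (2 * y) ^ r) by ring, hρr y hy] at h1
    refine le_trans (le_of_eq ?_) h1
    rw [Fintype.sum_option, ← Fin.sum_univ_eq_sum_range
      (fun k => ρ ^ k * min ((2 * y * 2 ^ k) ^ 2) (2 * y * 2 ^ k)), Finset.mul_sum]
    simp only [q, t, Option.elim, mul_zero, zero_pow two_ne_zero, min_self, zero_add]
    refine Finset.sum_congr rfl fun l _ => ?_
    rw [show y * 2 ^ ((l : ℕ) + 1) = 2 * y * 2 ^ (l : ℕ) by ring]
    ring
  let ι := (Fin N → Option (Fin L)) × (Fin N → ℤˣ)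
  let e := Fintype.equivFin ι
  let α : ι → Fin N → ℝ := fun i j =>
    (∏ k, q (i.1 k)) * (2 ^ N)⁻¹ * (((i.2 j : ℤ) : ℝ) * t (i.1 j))
  have hmass (ω : Fin N → Option (Fin L)) : 0 ≤ ∏ k, q (ω k) :=
    Finset.prod_nonneg fun _ _ => hq _
  refine ⟨Fintype.card ι, fun i => α (e.symm i), fun c => ?_, fun G _ _ z => ?_⟩
  · rw [e.symm.sum_comp fun i => |∑ j, α i j * c j|, Fintype.sum_prod_type]
    have hrw (c : Fin N → ℝ) : ∑ ω, ∑ ε, |∑ j, α (ω, ε) j * c j| =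
        ∑ ω : Fin N → Option (Fin L), (∏ i, q (ω i)) * ((2 ^ N)⁻¹ *
          ∑ ε : Fin N → ℤˣ, |∑ j, ((ε j : ℤ) : ℝ) * (t (ω j) * c j)|) := by
      refine Finset.sum_congr rfl fun ω _ => ?_
      rw [Finset.mul_sum, Finset.mul_sum]
      refine Finset.sum_congr rfl fun ε _ => ?_
      have h1 : ∑ j, α (ω, ε) j * c j = (∏ k, q (ω k)) * (2 ^ N)⁻¹ *
          ∑ j, ((ε j : ℤ) : ℝ) * (t (ω j) * c j) := by
        rw [Finset.mul_sum]
        exact Finset.sum_congr rfl fun j _ => by simp only [α]; ring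
      rw [h1, abs_mul, abs_of_nonneg (mul_nonneg (hmass ω) (by positivity)), mul_assoc]
    set S := ∑ j, |c j| ^ r with hS
    have hS0 : 0 ≤ S := Finset.sum_nonneg fun _ _ => by positivity
    rcases hS0.eq_or_lt with h0 | hpos
    · have hc (j : Fin N) : c j = 0 := by
        have := (Finset.sum_eq_zero_iff_of_nonneg (fun j _ => by positivity)).1 h0.symm j
          (Finset.mem_univ j)
        rw [Real.rpow_eq_zero (abs_nonneg _) hr0.ne'] at this
        exact abs_eq_zero.1 this
      simp only [hc, mul_zero, Finset.sum_const_zero, abs_zero]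
      positivity
    · set σ := S ^ (1 / r) with hσ
      have hσ0 : 0 < σ := by positivity
      have h1 := sum_prod_weight_abs_sum_sign_le hq hq1 ht hK hmoment (fun j => σ⁻¹ * c j) (by
        simp only [abs_mul, abs_inv, abs_of_pos hσ0]
        have (j : Fin N) : (σ⁻¹ * |c j|) ^ r = S⁻¹ * |c j| ^ r := by
          rw [Real.mul_rpow (by positivity) (abs_nonneg _), Real.inv_rpow hσ0.le, hσ,
            ← Real.rpow_mul hS0, one_div_mul_cancel hr0.ne', Real.rpow_one]
        simp only [this, ← Finset.mul_sum, ← hS]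
        rw [inv_mul_cancel₀ hpos.ne'])
      rw [← hrw] at h1
      have h2 : ∑ ω, ∑ ε, |∑ j, α (ω, ε) j * (σ⁻¹ * c j)| =
          σ⁻¹ * ∑ ω, ∑ ε, |∑ j, α (ω, ε) j * c j| := by
        simp only [Finset.mul_sum]
        refine Finset.sum_congr rfl fun ω _ => Finset.sum_congr rfl fun ε _ => ?_
        rw [← abs_of_pos (inv_pos.2 hσ0), ← abs_mul, Finset.mul_sum, abs_of_pos (inv_pos.2 hσ0)]
        congr 1
        exact Finset.sum_congr rfl fun j _ => by ring
      rw [h2, inv_mul_le_iff₀ hσ0, mul_comm] at h1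
      exact h1.trans (by gcongr; exact le_max_left _ _)
  · rw [e.symm.sum_comp fun i => ‖∑ j, (α i j : 𝕜) • z j‖, Fintype.sum_prod_type]
    have hrw (z : Fin N → G) : ∑ ω, ∑ ε, ‖∑ j, (α (ω, ε) j : 𝕜) • z j‖ =
        ∑ ω : Fin N → Option (Fin L), (∏ i, q (ω i)) * ((2 ^ N)⁻¹ *
          ∑ ε : Fin N → ℤˣ, ‖∑ j, ((ε j : ℤˣ) : ℤ) • ((t (ω j) : ℝ) : 𝕜) • z j‖) := by
      refine Finset.sum_congr rfl fun ω _ => ?_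
      rw [Finset.mul_sum, Finset.mul_sum]
      refine Finset.sum_congr rfl fun ε _ => ?_
      have h1 : ∑ j, (α (ω, ε) j : 𝕜) • z j = (((∏ k, q (ω k)) * (2 ^ N)⁻¹ : ℝ) : 𝕜) •
          ∑ j, ((ε j : ℤˣ) : ℤ) • ((t (ω j) : ℝ) : 𝕜) • z j := by
        rw [Finset.smul_sum]
        refine Finset.sum_congr rfl fun j _ => ?_
        rw [← Int.cast_smul_eq_zsmul 𝕜, smul_smul, smul_smul]
        congr 1
        simp only [α, RCLike.ofReal_mul, RCLike.ofReal_intCast]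
        ring
      rw [h1, norm_smul, RCLike.norm_ofReal, abs_of_nonneg (mul_nonneg (hmass ω) (by positivity)),
        mul_assoc]
    set S := ∑ j, ‖z j‖ ^ r with hS
    have hS0 : 0 ≤ S := Finset.sum_nonneg fun _ _ => by positivity
    rcases hS0.eq_or_lt with h0 | hpos
    · rw [← h0, Real.zero_rpow (by simpa using hr0.ne')]
      positivity
    · set σ := S ^ (1 / r) with hσ
      have hσ0 : 0 < σ := by positivity
      have hnorm (j : Fin N) : ‖((σ⁻¹ : ℝ) : 𝕜) • z j‖ = σ⁻¹ * ‖z j‖ := by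
        rw [norm_smul, RCLike.norm_ofReal, abs_of_pos (inv_pos.2 hσ0)]
      have hnorm1 : ∑ j, (σ⁻¹ * ‖z j‖) ^ r = 1 := by
        have (j : Fin N) : (σ⁻¹ * ‖z j‖) ^ r = S⁻¹ * ‖z j‖ ^ r := by
          rw [Real.mul_rpow (by positivity) (norm_nonneg _), Real.inv_rpow hσ0.le, hσ,
            ← Real.rpow_mul hS0, one_div_mul_cancel hr0.ne', Real.rpow_one]
        simp only [this, ← Finset.mul_sum, ← hS]
        rw [inv_mul_cancel₀ hpos.ne']
      have h1 := one_sub_exp_le_sum_prod_weight 𝕜 hq hq1 ht fun j => ((σ⁻¹ : ℝ) : 𝕜) • z j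
      rw [← hrw] at h1
      simp only [hnorm] at h1
      -- Terms of norm at most `2 ^ (-L)` contribute at most half of `∑ b j ^ r = 1`; each of the
      -- others meets an atom of mass at least `b j ^ r / 4`.
      have hprob (b : ℝ) (hb0 : 0 ≤ b) (hb1 : b ≤ 1) : b ^ r / 4 - (1 / 2) ^ L / 4 ≤
          ∑ o, q o * (if 1 ≤ t o * b then 1 else 0) := by
        have hnn : ∀ o, 0 ≤ q o * (if 1 ≤ t o * b then (1 : ℝ) else 0) := fun o =>
          mul_nonneg (hq o) (by split_ifs <;> simp)
        by_cases hbL : b ≤ (1 / 2) ^ L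
        · refine le_trans ?_ (Finset.sum_nonneg fun o _ => hnn o)
          have : b ^ r ≤ b := Real.rpow_le_self_of_le_one hb0 hb1 hr1.le
          linarith
        · have hbL := not_le.1 hbL
          have hbpos : 0 < b := lt_trans (by positivity) hbL
          obtain ⟨n, hn1, hn2⟩ := exists_nat_pow_near
            (show 1 ≤ b⁻¹ from (one_le_inv₀ hbpos).2 hb1) (one_lt_two (α := ℝ))
          have hnL : n < L := by
            by_contra! hLn
            have h2 : (2 : ℝ) ^ L ≤ 2 ^ n := pow_le_pow_right₀ (by norm_num) hLn
            have h3 : b⁻¹ < 2 ^ L := by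
              rw [inv_lt_comm₀ hbpos (by positivity)]
              simpa using hbL
            linarith
          refine le_trans ?_ (Finset.single_le_sum (fun o _ => hnn o)
            (Finset.mem_univ (some (⟨n, hnL⟩ : Fin L))))
          have h2 : 1 ≤ t (some ⟨n, hnL⟩) * b := by
            simp only [t, Option.elim]
            have := (inv_lt_iff_one_lt_mul₀ hbpos).1 hn2
            linarith
          rw [if_pos h2, mul_one]
          simp only [q, Option.elim]
          have h3 : b / 2 ≤ (2 : ℝ)⁻¹ ^ (n + 1) := by
            have : b ≤ (2 ^ n)⁻¹ := (le_inv_comm₀ hbpos (by positivity)).2 hn1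
            rw [inv_pow, pow_succ, mul_inv]
            linarith
          have h4 : (b / 2) ^ r ≤ ((2 : ℝ)⁻¹ ^ (n + 1)) ^ r := by gcongr
          have h5 : ((2 : ℝ)⁻¹ ^ (n + 1)) ^ r = ρ ^ (n + 1) := by
            rw [hρ, Real.rpow_neg (by norm_num), ← Real.inv_rpow (by norm_num),
              ← Real.rpow_natCast, ← Real.rpow_natCast, ← Real.rpow_mul (by positivity),
              ← Real.rpow_mul (by positivity), mul_comm]
          have h6 : b ^ r / 4 ≤ (b / 2) ^ r := by
            rw [Real.div_rpow hb0 (by norm_num)]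
            have : (2 : ℝ) ^ r ≤ 2 ^ (2 : ℝ) :=
              Real.rpow_le_rpow_of_exponent_le (by norm_num) hr2.le
            rw [Real.rpow_ofNat] at this
            gcongr
            linarith
          have h7 : (0 : ℝ) ≤ (1 / 2) ^ L / 4 := by positivity
          linarith
      have hb1 (j : Fin N) : σ⁻¹ * ‖z j‖ ≤ 1 := by
        have h2 : (σ⁻¹ * ‖z j‖) ^ r ≤ 1 := hnorm1 ▸ Finset.single_le_sum
          (f := fun j => (σ⁻¹ * ‖z j‖) ^ r) (fun j _ => by positivity) (Finset.mem_univ j)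
        rw [← Real.one_rpow r] at h2
        exact (Real.rpow_le_rpow_iff (by positivity) zero_le_one hr0).1 h2
      have hN : (N : ℝ) * (1 / 2) ^ L ≤ 1 / 2 := by
        have h2 : (N : ℝ) ≤ 2 ^ N := by exact_mod_cast Nat.lt_two_pow_self.le
        rw [one_div, inv_pow, ← div_eq_mul_inv, div_le_iff₀ (by positivity), pow_succ]
        linarith
      have h2 : 1 / 8 ≤ ∑ j, ∑ o, q o * (if 1 ≤ t o * (σ⁻¹ * ‖z j‖) then 1 else 0) := by
        refine le_trans ?_ (Finset.sum_le_sum fun j _ => hprob _ (by positivity) (hb1 j))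
        rw [Finset.sum_sub_distrib, ← Finset.sum_div, hnorm1]
        simp only [Finset.sum_const, Finset.card_univ, Fintype.card_fin, nsmul_eq_mul]
        linarith
      have h3 : κ ≤ ∑ ω, ∑ ε, ‖∑ j, (α (ω, ε) j : 𝕜) • ((σ⁻¹ : ℝ) : 𝕜) • z j‖ := by
        refine le_trans ?_ h1
        rw [hκ]
        gcongr
      have h4 : ∑ ω, ∑ ε, ‖∑ j, (α (ω, ε) j : 𝕜) • ((σ⁻¹ : ℝ) : 𝕜) • z j‖ =
          σ⁻¹ * ∑ ω, ∑ ε, ‖∑ j, (α (ω, ε) j : 𝕜) • z j‖ := by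
        simp only [Finset.mul_sum]
        refine Finset.sum_congr rfl fun ω _ => Finset.sum_congr rfl fun ε _ => ?_
        simp only [smul_comm _ ((σ⁻¹ : ℝ) : 𝕜), ← Finset.smul_sum]
        rw [norm_smul, RCLike.norm_ofReal, abs_of_pos (inv_pos.2 hσ0)]
      rw [h4, le_inv_mul_iff₀ hσ0] at h3
      calc σ ≤ κ⁻¹ * ∑ ω, ∑ ε, ‖∑ j, (α (ω, ε) j : 𝕜) • z j‖ := by
            rw [le_inv_mul_iff₀ hκ0]; linarith
        _ ≤ _ := by gcongr; exact le_max_right _ _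

/-! ### Comparison of the classes with the class of multiple `1`-summing mappings -/

section Multiple

universe u

theorem sum_pi_fin_succ {n : ℕ} {M : Fin (n + 1) → ℕ} {H : Type*} [AddCommMonoid H]
    (g : (∀ k, Fin (M k)) → H) :
    ∑ j, g j = ∑ j₀, ∑ j : (∀ k : Fin n, Fin (M k.succ)), g (Fin.cons j₀ j) := by
  rw [← (Fin.consEquiv fun k => Fin (M k)).sum_comp, Fintype.sum_prod_type]
  rfl

/-- The lower estimate for a family of coefficient matrices passes to their tensor product: one
index is handled at a time, the other coordinates being absorbed into an `ℓ_1` sum of copies of the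
space. -/
theorem rpow_sum_le_sum_prod_smul (𝕜 : Type*) [RCLike 𝕜] {r K : ℝ} (hr : 1 ≤ r) (hK : 0 ≤ K)
    {n : ℕ} {L N : Fin n → ℕ} (a : ∀ k, Fin (L k) → Fin (N k) → ℝ)
    (ha : ∀ (k : Fin n) (G : Type u) [NormedAddCommGroup G] [NormedSpace 𝕜 G] (z : Fin (N k) → G),
      (∑ j, ‖z j‖ ^ r) ^ (1 / r) ≤ K * ∑ i, ‖∑ j, (a k i j : 𝕜) • z j‖)
    {G : Type u} [NormedAddCommGroup G] [NormedSpace 𝕜 G] (z : (∀ k, Fin (N k)) → G) :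
    (∑ j, ‖z j‖ ^ r) ^ (1 / r) ≤
      K ^ n * ∑ i : (∀ k, Fin (L k)), ‖∑ j, (∏ k, (a k (i k) (j k) : 𝕜)) • z j‖ := by
  have hr0 : r ≠ 0 := by linarith
  induction n with
  | zero =>
    simp only [Fintype.sum_unique, Finset.univ_eq_empty, Finset.prod_empty, one_smul, pow_zero,
      one_mul]
    rw [← Real.rpow_mul (norm_nonneg _), mul_one_div_cancel hr0, Real.rpow_one]
  | succ n ih =>
    let b (j₀ : Fin (N 0)) (i : ∀ k : Fin n, Fin (L k.succ)) : G :=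
      ∑ j : (∀ k : Fin n, Fin (N k.succ)), (∏ k, (a k.succ (i k) (j k) : 𝕜)) •
        z (Fin.cons j₀ j)
    let B (j₀ : Fin (N 0)) : PiLp 1 fun _ : (∀ k : Fin n, Fin (L k.succ)) => G :=
      WithLp.toLp 1 (b j₀)
    have hB (j₀ : Fin (N 0)) : ‖B j₀‖ = ∑ i, ‖b j₀ i‖ := by
      rw [PiLp.norm_eq_of_L1]
    have h1 (j₀ : Fin (N 0)) : ∑ j : (∀ k : Fin n, Fin (N k.succ)), ‖z (Fin.cons j₀ j)‖ ^ r ≤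
        (K ^ n * ‖B j₀‖) ^ r := by
      have := ih (fun k => a k.succ) (fun k => ha k.succ) fun j => z (Fin.cons j₀ j)
      rw [hB]
      rwa [one_div, Real.rpow_inv_le_iff_of_pos (by positivity) (by positivity) (by linarith)]
        at this
    have h2 := ha 0 _ B
    have h3 (i₀ : Fin (L 0)) : ‖∑ j₀, (a 0 i₀ j₀ : 𝕜) • B j₀‖ =
        ∑ i : (∀ k : Fin n, Fin (L k.succ)), ‖∑ j₀, (a 0 i₀ j₀ : 𝕜) • b j₀ i‖ := by
      rw [PiLp.norm_eq_of_L1]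
      simp [B]
    have h4 (i₀ : Fin (L 0)) (i : ∀ k : Fin n, Fin (L k.succ)) :
        ∑ j, (∏ k, (a k ((Fin.cons i₀ i : ∀ k, Fin (L k)) k) (j k) : 𝕜)) • z j =
          ∑ j₀, (a 0 i₀ j₀ : 𝕜) • b j₀ i := by
      simp only [sum_pi_fin_succ, Fin.prod_univ_succ, Fin.cons_zero, Fin.cons_succ, b,
        Finset.smul_sum, smul_smul]
    have h5 : (∑ j₀, (K ^ n * ‖B j₀‖) ^ r) ^ (1 / r) = K ^ n * (∑ j₀, ‖B j₀‖ ^ r) ^ (1 / r) := by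
      have h6 (j₀ : Fin (N 0)) : (K ^ n * ‖B j₀‖) ^ r = (K ^ n) ^ r * ‖B j₀‖ ^ r :=
        Real.mul_rpow (by positivity) (norm_nonneg _)
      simp only [h6, ← Finset.mul_sum]
      rw [Real.mul_rpow (by positivity) (by positivity), ← Real.rpow_mul (by positivity),
        mul_one_div_cancel hr0, Real.rpow_one]
    calc (∑ j, ‖z j‖ ^ r) ^ (1 / r) ≤ (∑ j₀, (K ^ n * ‖B j₀‖) ^ r) ^ (1 / r) := by
          rw [sum_pi_fin_succ]
          gcongr with j₀ _
          exact h1 j₀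
      _ ≤ K ^ n * (K * ∑ i₀, ‖∑ j₀, (a 0 i₀ j₀ : 𝕜) • B j₀‖) := by rw [h5]; gcongr
      _ = _ := by
          simp only [h3, sum_pi_fin_succ (fun i : (∀ k, Fin (L k)) => ‖_‖), h4]
          ring

variable {𝕜 : Type*} [RCLike 𝕜] {n : ℕ} {E : Fin n → Type*}
  [∀ k, NormedAddCommGroup (E k)] [∀ k, NormedSpace 𝕜 (E k)]
  {F : Type*} [NormedAddCommGroup F] [NormedSpace 𝕜 F] {A : ContinuousMultilinearMap 𝕜 E F}

/-- The factorization of weakly `1`-summable families and Hölder's inequality for the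
multi-indexed sum. -/
theorem IsMultipleSumming.one_of_hasCotype_two (hE : ∀ k, HasCotype 2 (E k)) {r : ℝ} (hr1 : 1 < r)
    (hr2 : r < 2) (hA : IsMultipleSumming r (fun _ => r) A) :
    IsMultipleSumming 1 (fun _ => 1) A := by
  have hrs := Real.HolderConjugate.conjExponent hr1
  set s := r.conjExponent with hs_def
  have hs : 2 < s := by
    rw [hrs.conjugate_eq, lt_div_iff₀ hrs.sub_one_pos]
    linarith
  obtain ⟨C, hC, h⟩ := hA
  choose K hK hfac using fun k => (hE k).exists_smul_factorization 𝕜 hrs hs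
  refine ⟨C * ∏ k, K k, mul_nonneg hC (Finset.prod_nonneg fun k _ => hK k), fun m x => ?_⟩
  choose a y ha ha1 hxy hw using fun k => hfac k (m k) (x k)
  have hAx (j : ∀ k, Fin (m k)) : ‖A fun k => x k (j k)‖ =
      (∏ k, a k (j k)) * ‖A fun k => y k (j k)‖ := by
    simp only [hxy]
    rw [A.map_smul_univ, norm_smul, norm_prod]
    simp only [RCLike.norm_ofReal, abs_of_nonneg (ha _ _)]
  have hprod : ∑ j : (∀ k, Fin (m k)), (∏ k, a k (j k)) ^ s ≤ 1 := by
    have h1 (j : ∀ k, Fin (m k)) : (∏ k, a k (j k)) ^ s = ∏ k, a k (j k) ^ s :=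
      (Real.finsetProd_rpow _ _ (fun k _ => ha k _) s).symm
    have h2 := Finset.prod_univ_sum (fun k => (Finset.univ : Finset (Fin (m k))))
      fun k j => a k j ^ s
    rw [Fintype.piFinset_univ] at h2
    simp only [h1, ← h2]
    exact Finset.prod_le_one (fun k _ => Finset.sum_nonneg fun j _ => Real.rpow_nonneg (ha k j) _)
      fun k _ => ha1 k
  have hH := Real.inner_le_Lp_mul_Lq_of_nonneg Finset.univ hrs.symm
    (f := fun j : (∀ k, Fin (m k)) => ∏ k, a k (j k)) (g := fun j => ‖A fun k => y k (j k)‖)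
    (fun j _ => Finset.prod_nonneg fun k _ => ha k _) fun j _ => norm_nonneg _
  have h1 : (∑ j : (∀ k, Fin (m k)), (∏ k, a k (j k)) ^ s) ^ (1 / s) ≤ 1 :=
    Real.rpow_le_one (Finset.sum_nonneg fun j _ =>
      Real.rpow_nonneg (Finset.prod_nonneg fun k _ => ha k _) _) hprod (by positivity)
  simp only [Real.rpow_one, div_one, hAx]
  calc _ ≤ (∑ j : (∀ k, Fin (m k)), ‖A fun k => y k (j k)‖ ^ r) ^ (1 / r) :=
        hH.trans (mul_le_of_le_one_left (by positivity) h1)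
    _ ≤ C * ∏ k, weakLpNorm 𝕜 r (y k) := h m y
    _ ≤ C * ∏ k, (K k * weakLpNorm 𝕜 1 (x k)) := by
        gcongr with k _
        · exact fun k _ => weakLpNorm_nonneg _ _
        · exact hw k
    _ = _ := by rw [Finset.prod_mul_distrib, mul_assoc]

/-- The inclusion theorem: the defining inequality with exponent `1` is tested on the images of the
given families under the coefficient matrices of `exists_stable_coefficients`. -/
theorem IsMultipleSumming.of_one {r : ℝ} (hr1 : 1 < r) (hr2 : r < 2)
    (hA : IsMultipleSumming 1 (fun _ => 1) A) : IsMultipleSumming r (fun _ => r) A := by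
  obtain ⟨C, hC, h⟩ := hA
  obtain ⟨K, hK, hcoef⟩ := exists_stable_coefficients 𝕜 hr1 hr2
  refine ⟨K ^ n * (C * (2 * K) ^ n), by positivity, fun m x => ?_⟩
  choose L a hup hlow using fun k => hcoef (m k)
  let X (k : Fin n) (i : Fin (L k)) : E k := ∑ j, (a k i j : 𝕜) • x k j
  have hAX (i : ∀ k, Fin (L k)) : A (fun k => X k (i k)) =
      ∑ j : (∀ k, Fin (m k)), (∏ k, (a k (i k) (j k) : 𝕜)) • A fun k => x k (j k) := by
    simp only [X]
    rw [A.map_sum]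
    exact Finset.sum_congr rfl fun j _ => A.map_smul_univ _ _
  have hX (k : Fin n) : weakLpNorm 𝕜 1 (X k) ≤ 2 * K * weakLpNorm 𝕜 r (x k) := by
    refine weakLpNorm_le fun φ hφ => ?_
    simp only [Real.rpow_one, div_one]
    have hpart (c : Fin (m k) → ℝ) (hc : ∀ j, |c j| ≤ ‖φ (x k j)‖) :
        ∑ i, |∑ j, a k i j * c j| ≤ K * weakLpNorm 𝕜 r (x k) := by
      refine (hup k c).trans (mul_le_mul_of_nonneg_left ?_ hK)
      refine le_trans ?_ (le_weakLpNorm hr1.le (x k) hφ)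
      gcongr with j _
      exact hc j
    have hre := hpart _ fun j => RCLike.abs_re_le_norm (φ (x k j))
    have him := hpart _ fun j => RCLike.abs_im_le_norm (φ (x k j))
    have hsplit (i : Fin (L k)) : ‖φ (X k i)‖ ≤ |∑ j, a k i j * RCLike.re (φ (x k j))| +
        |∑ j, a k i j * RCLike.im (φ (x k j))| := by
      have hnorm (z : 𝕜) : ‖z‖ ≤ |RCLike.re z| + |RCLike.im z| := by
        refine le_of_sq_le_sq ?_ (by positivity)
        rw [RCLike.norm_sq_eq_def, add_sq, sq_abs, sq_abs]
        nlinarith [mul_nonneg (abs_nonneg (RCLike.re z)) (abs_nonneg (RCLike.im z))]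
      refine (hnorm _).trans_eq ?_
      simp [X, map_sum]
    refine (Finset.sum_le_sum fun i _ => hsplit i).trans ?_
    rw [Finset.sum_add_distrib]
    linarith
  have h1 := h L X
  simp only [Real.rpow_one, div_one] at h1
  calc _ ≤ K ^ n * ∑ i : (∀ k, Fin (L k)),
          ‖∑ j : (∀ k, Fin (m k)), (∏ k, (a k (i k) (j k) : 𝕜)) • A fun k => x k (j k)‖ :=
        rpow_sum_le_sum_prod_smul 𝕜 hr1.le hK a (fun k G => hlow k G) _
    _ = K ^ n * ∑ i : (∀ k, Fin (L k)), ‖A fun k => X k (i k)‖ := by simp only [hAX]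
    _ ≤ K ^ n * (C * ∏ k, weakLpNorm 𝕜 1 (X k)) := by gcongr
    _ ≤ K ^ n * (C * ∏ k, (2 * K * weakLpNorm 𝕜 r (x k))) := by
        gcongr with k _
        · exact fun k _ => weakLpNorm_nonneg _ _
        · exact hX k
    _ = _ := by
        rw [Finset.prod_mul_distrib, Finset.prod_const, Finset.card_univ, Fintype.card_fin]
        ring

theorem multipleSummingMaps_eq_one (hE : ∀ k, HasCotype 2 (E k)) {r : ℝ} (hr1 : 1 ≤ r)
    (hr2 : r < 2) : multipleSummingMaps 𝕜 E F r = multipleSummingMaps 𝕜 E F 1 := by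
  rcases hr1.eq_or_lt with rfl | hr
  · rfl
  · ext A
    exact ⟨fun h => h.one_of_hasCotype_two hE hr hr2, fun h => h.of_one hr hr2⟩

end Multiple

theorem mainTheorem2 {𝕜 : Type*} [RCLike 𝕜] {n : ℕ} (hn : 1 ≤ n) (E : Fin n → Type*)
    [∀ k, NormedAddCommGroup (E k)] [∀ k, NormedSpace 𝕜 (E k)] [∀ k, CompleteSpace (E k)]
    (F : Type*) [NormedAddCommGroup F] [NormedSpace 𝕜 F] [CompleteSpace F]
    (hE : ∀ k, HasCotype 2 (E k)) (p r : ℝ) (hp : 1 ≤ p) (hpr : p ≤ r) (hr : r < 2) :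
    multipleSummingMaps 𝕜 E F p = multipleSummingMaps 𝕜 E F r := by
  rw [multipleSummingMaps_eq_one hE hp (hpr.trans_lt hr),
    multipleSummingMaps_eq_one hE (hp.trans hpr) hr]
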